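/- Let $c\in\mathbb{C}\setminus\{0\}$ and put $g(x,y)=\frac{c}{x-y}$, $f(x,y)=1+g(x,y)$, $h(x,y)=\frac{x-y+c}{c}$. Put $[1]=[2]=0$, $[3]=1$. Let $\mathcal A$ be an associative unital $\mathbb{C}$-algebra with elements $T_{ij}(u)$ ($1\le i,j\le 3$, $u\in\mathbb{C}$) satisfying the $\mathfrak{gl}(2|1)$ RTT relations: for all $u\neq v$ and all $i,j,k,l$, $$T_{ij}(u)T_{kl}(v)-(-1)^{([i]+[j])([k]+[l])}T_{kl}(v)T_{ij}(u)=(-1)^{[i]([k]+[l])+[k][l]}\,g(u,v)\bigl(T_{kj}(v)T_{il}(u)-T_{kj}(u)T_{il}(v)\bigr).$$ For finite families of variables, write $f(\bar x,\bar y)=\prod_{j,k}f(x_j,y_k)$, and similarly for $g$ and $h$; for $(i,j)\in\{(1,2),(2,2)\}$ let $T_{ij}(\bar u)=\prod_k T_{ij}(u_k)$; for $j=1,2$ let $$\mathbb{T}_{j3}(v_1,\dots,v_n)=\frac{T_{j3}(v_1)\cdots T_{j3}(v_n)}{\prod_{n\ge \ell>m\ge1}h(v_\ell,v_m)}.$$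 In these products the elements of every subfamily are taken in increasing order of their subscripts. For $\#\bar x=\#\bar y=n$ let $$K(\bar x|\bar y)=\prod_{j<k}g(x_j,x_k)\prod_{j>k}g(y_j,y_k)\;h(\bar x,\bar y)\;\det_{1\le j,k\le n}\left(\frac{g(x_j,y_k)}{h(x_j,y_k)}\right),\qquad K(\emptyset|\emptyset)=1.$$ For $\#\bar u=a$ and $\#\bar v=b$ define $$Y_{a,b}(\bar u,\bar v)=\sum K(\bar v_\alpha|\bar u_\alpha)\,f(\bar u_\alpha,\bar u_{\bar\alpha})\,g(\bar v_{\bar\alpha},\bar v_\alpha)\;\mathbb{T}_{13}(\bar v_\alpha)\,\mathbb{T}_{23}(\bar v_{\bar\alpha})\,T_{12}(\bar u_{\bar\alpha})\,T_{22}(\bar u_\alpha),$$ where the sum is over all partitions of $\bar u$ into disjoint subsets $\bar u_\alpha,\bar u_{\bar\alpha}$ and of $\bar v$ into disjoint subsets $\bar v_\alpha,\bar v_{\bar\alpha}$ with $\#\bar u_\alpha=\#\bar v_\alpha$. Let $a\ge1$, $b\ge0$, and let $\bar u=\{u_1,\dots,u_a\}$, $\bar v=\{v_1,\dots,v_b\}$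 be complex numbers such that $u_1,\dots,u_a,v_1,\dots,v_b$ are pairwise distinct, $h(v_j,v_k)\ne0$ for $j\ne k$, and $h(v_j,u_i)\neq0$ for all $i,j$. Write $\bar u_a=\bar u\setminus\{u_a\}$. Then $$Y_{a,b}(\bar u,\bar v)=T_{12}(u_a)\,Y_{a-1,b}(\bar u_a,\bar v)+\sum g(\bar v_\rho,u_a)\,f(\bar v_\rho,\bar u_a)\,g(\bar v_{\bar\rho},\bar v_\rho)\;T_{13}(u_a)\,Y_{a-1,b-1}(\bar u_a,\bar v_{\bar\rho})\,T_{22}(\bar v_\rho),$$ where the sum is over partitions of $\bar v$ into $\bar v_\rho$ and $\bar v_{\bar\rho}$ with $\#\bar v_\rho=1$ (an empty sum if $b=0$). -/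

import Mathlib

namespace GL21

open Finset

noncomputable section

/-- `g(x,y) = c / (x - y)`. -/
def g (c x y : ℂ) : ℂ := c / (x - y)

/-- `f(x,y) = 1 + g(x,y)`. -/
def f (c x y : ℂ) : ℂ := 1 + g c x y

/-- `h(x,y) = (x - y + c) / c`, which is `f(x,y) / g(x,y)` for `x ≠ y`, `c ≠ 0`. -/
def h (c x y : ℂ) : ℂ := (x - y + c) / c

/-- The parity of the basis vectors of `ℂ^{2|1}`. The usual indices `1, 2, 3` are written `0, 1, 2 : Fin 3`. -/
def parity (i : Fin 3) : ℕ := if i = 2 then 1 else 0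

/-- The entries `T i j u` of the monodromy matrix satisfy the commutation relations of the
`gl(2|1)` graded RTT algebra, for all spectral parameters `x ≠ y`. -/
def IsRTT {A : Type*} [Ring A] [Algebra ℂ A] (c : ℂ) (T : Fin 3 → Fin 3 → ℂ → A) : Prop :=
  ∀ (i j k l : Fin 3) (x y : ℂ), x ≠ y →
    T i j x * T k l y
        - ((-1 : ℂ) ^ ((parity i + parity j) * (parity k + parity l))) • (T k l y * T i j x) =
      ((-1 : ℂ) ^ (parity i * (parity k + parity l) + parity k * parity l) * g c x y) •
        (T k j y * T i l x - T k j x * T i l y)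

/-- The domain wall partition function `K(x|y)` of two `n`-tuples (equal to `1` for `n = 0`). -/
def K (c : ℂ) {n : ℕ} (x y : Fin n → ℂ) : ℂ :=
  (∏ j : Fin n, ∏ k ∈ univ.filter (fun k => j < k), g c (x j) (x k)) *
    (∏ j : Fin n, ∏ k ∈ univ.filter (fun k => k < j), g c (y j) (y k)) *
    (∏ j : Fin n, ∏ k : Fin n, h c (x j) (y k)) *
    (Matrix.of fun j k : Fin n => g c (x j) (y k) / h c (x j) (y k)).det

section Operators

variable {A : Type*} [Ring A] [Algebra ℂ A] {ι κ : Type*} [LinearOrder ι] [LinearOrder κ]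

/-- `O(w_s)`: the product of the operators `O (w k)`, `k ∈ s`, in increasing order of `k`. -/
def opProd (O : ℂ → A) (w : ι → ℂ) (s : Finset ι) : A :=
  ((s.sort (· ≤ ·)).map fun k => O (w k)).prod

/-- The symmetric product of the odd operators `O (w k)`, `k ∈ s` (used with `O = T_{j3}`):
the naturally ordered product divided by `∏_{ℓ > m} h(w_ℓ, w_m)`. -/
def symProd (c : ℂ) (O : ℂ → A) (w : ι → ℂ) (s : Finset ι) : A :=
  (∏ l ∈ s, ∏ m ∈ s.filter (fun m => m < l), h c (w l) (w m))⁻¹ • opProd O w s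

/-- The operator `Y_{a,b}(ū_I, v̄_J)`, `a = #I`, `b = #J`, for the sets of variables
`ū_I = {u_i}_{i ∈ I}` and `v̄_J = {v_j}_{j ∈ J}`. The sum runs over the partitions of `ū_I` into
`ū_α` and `ū_{I \ α}` and of `v̄_J` into `v̄_β` and `v̄_{J \ β}` with `#α = #β`. -/
def Y (c : ℂ) (T : Fin 3 → Fin 3 → ℂ → A) (u : ι → ℂ) (v : κ → ℂ)
    (I : Finset ι) (J : Finset κ) : A :=
  ∑ α ∈ I.powerset, ∑ β ∈ J.powerset,
    if hc : #β = #α then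
      (K c (fun i => v (β.orderEmbOfFin hc i)) (fun i => u (α.orderEmbOfFin rfl i)) *
        (∏ i ∈ α, ∏ i' ∈ I \ α, f c (u i) (u i')) *
        (∏ j ∈ J \ β, ∏ j' ∈ β, g c (v j) (v j'))) •
        (symProd c (T 0 2) v β * symProd c (T 1 2) v (J \ β) *
          opProd (T 0 1) u (I \ α) * opProd (T 1 1) u α)
    else 0

end Operators

end

end GL21

/-!
Writing `J` for the odd variables already present, adding one more odd variable `v_j` to `Y` amounts
to acting by `T_{23}(v_j)` dressed with a correction: `T_{13}(v_j)` times the sum over the ways to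
turn one factor `T_{12}(u_i)` into `T_{22}(u_i)`, with weight `g(v_j, u_i) f(v̄_J, u_i)`. This rests
on the recursion for `K` in one of its arguments, which comes from expanding the determinant along
a row: the coefficients of the expansion are partial fractions whose extra poles contribute
determinants with a repeated row. The dressed operators satisfy the same exchange relations as the
bare `T_{2j}`, so the actions on `Y` of `T_{22}(z)`, suitably dressed, and then of `T_{12}(u_a)`
follow by induction on the number of odd variables.
-/

namespace GL21

open Finset

noncomputable section

section Scalars

open Polynomial

variable {c : ℂ}

theorem g_swap (c x y : ℂ) : g c y x = -g c x y := by
  rw [g, g, ← neg_sub x y, div_neg]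

theorem g_mul_g {x y z : ℂ} (hxy : x ≠ y) (hyz : y ≠ z) (hxz : x ≠ z) :
    g c x y * g c y z = g c x z * (g c x y + g c y z) := by
  have := sub_ne_zero.2 hxy
  have := sub_ne_zero.2 hyz
  have := sub_ne_zero.2 hxz
  unfold g
  field_simp
  ring

theorem f_eq_g_mul_h (hc : c ≠ 0) {x y : ℂ} (hxy : x ≠ y) : f c x y = g c x y * h c x y := by
  have := sub_ne_zero.2 hxy
  unfold f g h
  field_simp

theorem prod_f_eq_prod_g_mul_prod_h (hc : c ≠ 0) {σ : Type*} {t : σ → ℂ} {s : Finset σ} {y : ℂ}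
    (hy : ∀ i ∈ s, t i ≠ y) :
    ∏ i ∈ s, f c (t i) y = (∏ i ∈ s, g c (t i) y) * ∏ i ∈ s, h c (t i) y := by
  rw [← prod_mul_distrib]
  exact prod_congr rfl fun i hi => f_eq_g_mul_h hc (hy i hi)

theorem g_mul_h_swap (hc : c ≠ 0) {x y : ℂ} (hxy : x ≠ y) :
    g c x y * h c y x = g c x y - 1 := by
  have := sub_ne_zero.2 hxy
  unfold g h
  field_simp
  ring

theorem h_self (hc : c ≠ 0) (x : ℂ) : h c x x = 1 := by
  simp [h, hc]

theorem prod_g_mul_eval (s : Finset ℂ) {P : ℂ[X]} (hP : P.degree < #s) {x : ℂ} (hx : x ∉ s) :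
    (∏ t ∈ s, g c t x) * P.eval x =
      ∑ t ∈ s, g c t x * (∏ l ∈ s.erase t, g c l t) * P.eval t := by
  have g_eq (y z : ℂ) : g c y z = -c * (z - y)⁻¹ := by
    rw [g, ← neg_sub z y, div_neg, neg_mul, div_eq_mul_inv]
  have hne (t : ℂ) (ht : t ∈ s) : x ≠ t := fun e => hx (e ▸ ht)
  have interpolation : P.eval x = (∏ t ∈ s, (x - t)) *
      ∑ t ∈ s, Lagrange.nodalWeight s id t * (x - t)⁻¹ * P.eval t := by
    conv_lhs => rw [Lagrange.eq_interpolate Function.injective_id.injOn hP]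
    rw [Lagrange.eval_interpolate_not_at_node (v := id) _ hne, Lagrange.eval_nodal]
    rfl
  have cancel : (∏ t ∈ s, g c t x) * ∏ t ∈ s, (x - t) = (-c) ^ #s := by
    rw [← prod_mul_distrib, ← prod_const]
    refine prod_congr rfl fun t ht => ?_
    rw [g_eq, mul_assoc, inv_mul_cancel₀ (sub_ne_zero.2 (hne t ht)), mul_one]
  rw [interpolation, ← mul_assoc, cancel, mul_sum]
  refine sum_congr rfl fun t ht => ?_
  have weight : ∏ l ∈ s.erase t, g c l t = (-c) ^ (#s - 1) * Lagrange.nodalWeight s id t := by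
    rw [Lagrange.nodalWeight, ← card_erase_of_mem ht, ← prod_const, ← prod_mul_distrib]
    exact prod_congr rfl fun l _ => g_eq l t
  rw [weight, g_eq, ← Nat.sub_add_cancel (card_pos.2 ⟨t, ht⟩), pow_succ]
  simp only [Nat.add_sub_cancel]
  ring

theorem prod_g_mul_g_mul_eval {σ : Type*} [DecidableEq σ] {t : σ → ℂ}
    (ht : Function.Injective t) (s : Finset σ) {P : ℂ[X]} (hP : P.degree ≤ #s) {x z : ℂ}
    (hxz : x ≠ z) (hx : ∀ i ∈ s, t i ≠ x) (hz : ∀ i ∈ s, t i ≠ z) :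
    (∏ i ∈ s, g c (t i) x) * g c x z * P.eval x =
      (∏ i ∈ s, g c (t i) z) * g c x z * P.eval z +
        ∑ i ∈ s, g c (t i) x * (∏ l ∈ s.erase i, g c (t l) (t i)) * g c (t i) z *
          P.eval (t i) := by
  let e : σ ↪ ℂ := ⟨t, ht⟩
  have hzs : z ∉ s.map e := by simpa [e] using hz
  have hxs : x ∉ insert z (s.map e) := by simpa [e, hxz] using hx
  have hcard : P.degree < #(insert z (s.map e)) := by
    rw [card_insert_of_notMem hzs, card_map]
    exact hP.trans_lt (by exact_mod_cast Nat.lt_succ_self _)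
  have expansion := prod_g_mul_eval (c := c) _ hcard hxs
  rw [prod_insert hzs, sum_insert hzs, erase_insert hzs] at expansion
  have terms : ∑ y ∈ s.map e, g c y x * (∏ l ∈ (insert z (s.map e)).erase y, g c l y) *
      P.eval y = -∑ i ∈ s, g c (t i) x * (∏ l ∈ s.erase i, g c (t l) (t i)) * g c (t i) z *
        P.eval (t i) := by
    rw [sum_map, ← sum_neg_distrib]
    refine sum_congr rfl fun i hi => ?_
    have hzi : z ≠ e i := (hz i hi).symm
    rw [erase_insert_of_ne hzi, ← map_erase,
      prod_insert (fun hm => hzs (map_subset_map.2 (erase_subset _ _) hm)), prod_map,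
      g_swap c (e i) z]
    simp only [e, Function.Embedding.coeFn_mk]
    ring
  rw [terms, prod_map, prod_map, g_swap c x z] at expansion
  simp only [e, Function.Embedding.coeFn_mk] at expansion
  linear_combination -expansion

theorem prod_g_mul_g_mul_prod_affine {σ : Type*} [DecidableEq σ] {t : σ → ℂ}
    (ht : Function.Injective t) (s : Finset σ) {p : σ → ℂ → ℂ} (a b : σ → ℂ)
    (hp : ∀ i y, p i y = a i * y + b i) {x z : ℂ}
    (hxz : x ≠ z) (hx : ∀ i ∈ s, t i ≠ x) (hz : ∀ i ∈ s, t i ≠ z) :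
    (∏ i ∈ s, g c (t i) x) * g c x z * ∏ i ∈ s, p i x =
      (∏ i ∈ s, g c (t i) z) * g c x z * (∏ i ∈ s, p i z) +
        ∑ i ∈ s, g c (t i) x * (∏ l ∈ s.erase i, g c (t l) (t i)) * g c (t i) z *
          ∏ l ∈ s, p l (t i) := by
  let P : ℂ[X] := ∏ i ∈ s, (C (a i) * X + C (b i))
  have degree_le : P.degree ≤ #s :=
    (degree_prod_le _ _).trans ((sum_le_sum fun _ _ => degree_linear_le).trans (by simp))
  have eval_eq (y : ℂ) : P.eval y = ∏ i ∈ s, p i y := by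
    simp only [P, eval_prod, eval_add, eval_mul, eval_C, eval_X, hp]
  simpa only [eval_eq] using prod_g_mul_g_mul_eval (c := c) ht s degree_le hxz hx hz

theorem prod_f_mul_g (hc : c ≠ 0) {σ : Type*} [DecidableEq σ] {t : σ → ℂ}
    (ht : Function.Injective t) (s : Finset σ) {x z : ℂ}
    (hxz : x ≠ z) (hx : ∀ i ∈ s, t i ≠ x) (hz : ∀ i ∈ s, t i ≠ z) :
    (∏ i ∈ s, f c (t i) x) * g c x z = (∏ i ∈ s, f c (t i) z) * g c x z +
      ∑ i ∈ s, g c (t i) x * (∏ l ∈ s.erase i, f c (t l) (t i)) * g c (t i) z := by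
  have h_affine (i : σ) (y : ℂ) : h c (t i) y = -c⁻¹ * y + (1 + t i / c) := by
    unfold h
    field_simp
    ring
  rw [prod_f_eq_prod_g_mul_prod_h hc hx, prod_f_eq_prod_g_mul_prod_h hc hz, mul_right_comm,
    prod_g_mul_g_mul_prod_affine ht s _ _ h_affine hxz hx hz, mul_right_comm]
  congr 1
  refine sum_congr rfl fun i hi => ?_
  rw [prod_f_eq_prod_g_mul_prod_h hc fun l hl => ht.ne (ne_of_mem_erase hl),
    ← mul_prod_erase s _ hi, h_self hc]
  ring

end Scalars

section Izergin

variable {c : ℂ} {n : ℕ}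

theorem K_comp_perm (x y : Fin n → ℂ) (σ τ : Equiv.Perm (Fin n)) :
    K c (x ∘ σ) (y ∘ τ) = K c x y := by
  have prod_x := σ.prod_Ioi_comp_eq_sign_mul_prod (f := fun j k => g c (x j) (x k))
    fun j k => g_swap c (x k) (x j)
  have prod_y := τ.prod_Iio_comp_eq_sign_mul_prod (f := fun k j => g c (y j) (y k))
    fun j k => g_swap c (y j) (y k)
  have prod_h : ∏ j, ∏ k, h c (x (σ j)) (y (τ k)) = ∏ j, ∏ k, h c (x j) (y k) := by
    rw [← Equiv.prod_comp σ fun j => ∏ k, h c (x j) (y k)]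
    exact prod_congr rfl fun j _ => Equiv.prod_comp τ fun k => h c (x (σ j)) (y k)
  have det_eq : (Matrix.of fun j k => g c (x (σ j)) (y (τ k)) / h c (x (σ j)) (y (τ k))).det =
      σ.sign * τ.sign * (Matrix.of fun j k => g c (x j) (y k) / h c (x j) (y k)).det := by
    rw [mul_assoc, ← Matrix.det_permute', ← Matrix.det_permute]
    rfl
  have sign_sq (π : Equiv.Perm (Fin n)) : (π.sign : ℂ) * π.sign = 1 := by
    rw [← Int.cast_mul, ← Units.val_mul, Int.units_mul_self, Units.val_one, Int.cast_one]
  simp only [K, Function.comp_apply, filter_lt_eq_Ioi, filter_gt_eq_Iio, prod_x, prod_y, prod_h,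
    det_eq]
  set A := ∏ j, ∏ k ∈ Ioi j, g c (x j) (x k)
  set B := ∏ j, ∏ k ∈ Iio j, g c (y j) (y k)
  set H := ∏ j, ∏ k, h c (x j) (y k)
  set D := (Matrix.of fun j k => g c (x j) (y k) / h c (x j) (y k)).det
  linear_combination A * B * H * D * ((τ.sign : ℂ) * τ.sign * sign_sq σ + sign_sq τ)

/-- The `k`-th cofactor along the first row of the determinant in `K(x₀, x|y)`. -/
def izerginCofactor (c : ℂ) (x : Fin n → ℂ) (y : Fin (n + 1) → ℂ) (k : Fin (n + 1)) : ℂ :=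
  (-1) ^ (k : ℕ) * (Matrix.of fun i l : Fin n =>
    g c (x i) (y (k.succAbove l)) / h c (x i) (y (k.succAbove l))).det

theorem sum_izerginCofactor_mul_eq_zero (x : Fin n → ℂ) (y : Fin (n + 1) → ℂ)
    (hh : ∀ j k, h c (x j) (y k) ≠ 0) (j : Fin n) :
    ∑ k, izerginCofactor c x y k *
      (g c (x j) (y k) * ∏ l : Fin n, h c (x j) (y (k.succAbove l))) = 0 := by
  let M (i : Fin n) (k : Fin (n + 1)) : ℂ := g c (x i) (y k) / h c (x i) (y k)
  -- Up to the factor `∏ l, h c (x j) (y l)`, the sum is a determinant with a repeated row.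
  have repeated_row : (Matrix.of (Fin.cons (M j) M : Fin (n + 1) → Fin (n + 1) → ℂ)).det = 0 :=
    Matrix.det_zero_of_row_eq (Fin.succ_ne_zero j).symm (by ext; simp)
  rw [Matrix.det_succ_row_zero] at repeated_row
  rw [← mul_zero (∏ l, h c (x j) (y l)), ← repeated_row, mul_sum]
  refine sum_congr rfl fun k _ => ?_
  rw [Fin.prod_univ_succAbove _ k]
  have first_row : Matrix.of (Fin.cons (M j) M : Fin (n + 1) → Fin (n + 1) → ℂ) 0 k =
      g c (x j) (y k) / h c (x j) (y k) := rfl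
  have cofactor : izerginCofactor c x y k = (-1) ^ (k : ℕ) *
      ((Matrix.of (Fin.cons (M j) M : Fin (n + 1) → Fin (n + 1) → ℂ)).submatrix
        Fin.succ k.succAbove).det := rfl
  rw [first_row, cofactor]
  have := hh j k
  field_simp

theorem K_eq_sum_izerginCofactor (x y : Fin (n + 1) → ℂ) (hh : ∀ k, h c (x 0) (y k) ≠ 0) :
    K c x y = (-1) ^ n *
      (∏ j : Fin n, ∏ k ∈ univ.filter (fun k => j < k), g c (x j.succ) (x k.succ)) *
      (∏ j, ∏ k ∈ univ.filter (fun k => k < j), g c (y j) (y k)) *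
      (∏ j : Fin n, ∏ k, h c (x j.succ) (y k)) *
      ∑ k, izerginCofactor c (fun j => x j.succ) y k *
        ((∏ j : Fin n, g c (x j.succ) (x 0)) * g c (x 0) (y k) *
          ∏ l : Fin n, h c (x 0) (y (k.succAbove l))) := by
  have prod_x : ∏ j, ∏ k ∈ univ.filter (fun k => j < k), g c (x j) (x k) =
      (-1) ^ n * (∏ j : Fin n, g c (x j.succ) (x 0)) *
        ∏ j : Fin n, ∏ k ∈ univ.filter (fun k => j < k), g c (x j.succ) (x k.succ) := by
    simp only [prod_filter, Fin.prod_univ_succ (n := n), if_false, one_mul, Fin.succ_pos, if_true,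
      Fin.not_lt_zero, Fin.succ_lt_succ_iff, ← Fin.prod_const, ← prod_mul_distrib,
      g_swap c (x (Fin.succ _)) (x 0), neg_one_mul]
  rw [K, prod_x, Matrix.det_succ_row_zero, Fin.prod_univ_succ fun j => ∏ k, h c (x j) (y k),
    mul_sum, mul_sum]
  refine sum_congr rfl fun k _ => ?_
  rw [Fin.prod_univ_succAbove (fun l => h c (x 0) (y l)) k]
  have := hh k
  simp only [izerginCofactor, Matrix.of_apply, Matrix.submatrix]
  field_simp

theorem prod_mul_izerginCofactor (x : Fin n → ℂ) (y : Fin (n + 1) → ℂ) (k : Fin (n + 1)) :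
    (∏ j : Fin n, ∏ k ∈ univ.filter (fun k => j < k), g c (x j) (x k)) *
      (∏ j, ∏ k ∈ univ.filter (fun k => k < j), g c (y j) (y k)) *
      (∏ j, ∏ k, h c (x j) (y k)) * izerginCofactor c x y k =
    (∏ l : Fin n, g c (y (k.succAbove l)) (y k)) * (∏ j, h c (x j) (y k)) *
      K c x fun l => y (k.succAbove l) := by
  have prod_y : (-1) ^ (k : ℕ) * ∏ j, ∏ k ∈ univ.filter (fun k => k < j), g c (y j) (y k) =
      (∏ j : Fin n, g c (y (k.succAbove j)) (y k)) *
        ∏ j : Fin n, ∏ l ∈ univ.filter (fun l => l < j),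
          g c (y (k.succAbove j)) (y (k.succAbove l)) := by
    have cycle := Equiv.Perm.prod_Iio_comp_eq_sign_mul_prod k.cycleRange.symm
      (f := fun k j => g c (y j) (y k)) fun j k => g_swap c (y j) (y k)
    simp only [Equiv.Perm.sign_symm, Fin.sign_cycleRange, ← filter_gt_eq_Iio] at cycle
    push_cast at cycle
    rw [← cycle]
    simp only [prod_filter, Fin.prod_univ_succ (n := n), Fin.cycleRange_symm_succ,
      Fin.cycleRange_symm_zero, lt_self_iff_false, if_false, one_mul, Fin.not_lt_zero,
      Fin.succ_pos, if_true, Fin.succ_lt_succ_iff, prod_mul_distrib, prod_const_one]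
  have prod_h : ∏ j, ∏ k, h c (x j) (y k) = (∏ j, h c (x j) (y k)) *
      ∏ j, ∏ l : Fin n, h c (x j) (y (k.succAbove l)) := by
    rw [← prod_mul_distrib]
    exact prod_congr rfl fun j _ => Fin.prod_univ_succAbove _ k
  rw [K, izerginCofactor, prod_h]
  set A := ∏ j : Fin n, ∏ k ∈ univ.filter (fun k => j < k), g c (x j) (x k)
  set H := (∏ j, h c (x j) (y k)) * ∏ j, ∏ l : Fin n, h c (x j) (y (k.succAbove l))
  set D := (Matrix.of fun i l : Fin n =>
    g c (x i) (y (k.succAbove l)) / h c (x i) (y (k.succAbove l))).det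
  linear_combination A * H * D * prod_y

theorem sum_izerginCofactor_partialFraction (hc : c ≠ 0) (x y : Fin (n + 1) → ℂ)
    (hx : Function.Injective x) (hxy : ∀ j k, x j ≠ y k) (hh : ∀ j k, h c (x j) (y k) ≠ 0) :
    ∑ k, izerginCofactor c (fun j => x j.succ) y k *
        ((∏ j : Fin n, g c (x j.succ) (x 0)) * g c (x 0) (y k) *
          ∏ l : Fin n, h c (x 0) (y (k.succAbove l))) =
      ∑ k, izerginCofactor c (fun j => x j.succ) y k *
        ((∏ j : Fin n, g c (x j.succ) (y k)) * g c (x 0) (y k) *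
          ∏ l : Fin n, h c (y k) (y (k.succAbove l))) := by
  have h_affine (k : Fin (n + 1)) (l : Fin n) (z : ℂ) :
      h c z (y (k.succAbove l)) = c⁻¹ * z + (1 - y (k.succAbove l) / c) := by
    unfold h
    field_simp
    ring
  have expansion (k : Fin (n + 1)) := prod_g_mul_g_mul_prod_affine (c := c)
    (hx.comp (Fin.succ_injective n)) univ _ _ (h_affine k) (hxy 0 k)
    (fun i _ => hx.ne (Fin.succ_ne_zero i)) (fun i _ => hxy _ k)
  simp only [Function.comp_apply] at expansion
  simp only [expansion, mul_add, sum_add_distrib, mul_sum]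
  rw [add_eq_left, sum_comm]
  refine sum_eq_zero fun i _ => ?_
  rw [← mul_zero (g c (x i.succ) (x 0) * ∏ l ∈ univ.erase i, g c (x l.succ) (x i.succ)),
    ← sum_izerginCofactor_mul_eq_zero (fun j => x j.succ) y (fun j k => hh _ _) i, mul_sum]
  exact sum_congr rfl fun k _ => by ring

theorem K_succ (hc : c ≠ 0) (x y : Fin (n + 1) → ℂ)
    (hx : Function.Injective x) (hy : Function.Injective y) (hxy : ∀ j k, x j ≠ y k)
    (hh : ∀ j k, h c (x j) (y k) ≠ 0) :
    K c x y = ∑ k, g c (x 0) (y k) * (∏ l : Fin n, f c (y k) (y (k.succAbove l))) *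
      (∏ j : Fin n, f c (x j.succ) (y k)) *
      K c (fun j => x j.succ) (fun l => y (k.succAbove l)) := by
  rw [K_eq_sum_izerginCofactor x y (hh 0), sum_izerginCofactor_partialFraction hc x y hx hxy hh,
    mul_sum]
  refine sum_congr rfl fun k _ => ?_
  have prod_f_y : ∏ l : Fin n, f c (y k) (y (k.succAbove l)) =
      (-1) ^ n * (∏ l : Fin n, g c (y (k.succAbove l)) (y k)) *
        ∏ l : Fin n, h c (y k) (y (k.succAbove l)) := by
    rw [← Fin.prod_const, ← prod_mul_distrib, ← prod_mul_distrib]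
    refine prod_congr rfl fun l _ => ?_
    rw [f_eq_g_mul_h hc (hy.ne (Fin.succAbove_ne k l).symm), g_swap c (y (k.succAbove l)),
      neg_one_mul]
  rw [prod_f_y, prod_f_eq_prod_g_mul_prod_h hc fun j _ => hxy j.succ k]
  linear_combination (-1) ^ n * g c (x 0) (y k) * (∏ j : Fin n, g c (x j.succ) (y k)) *
    (∏ l : Fin n, h c (y k) (y (k.succAbove l))) *
    prod_mul_izerginCofactor (c := c) (fun j => x j.succ) y k

end Izergin

section PowersetSums

variable {ι M : Type*} [DecidableEq ι] [AddCommMonoid M]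

theorem sum_powerset_sum_mem (J : Finset ι) (G : ι → Finset ι → M) :
    ∑ β ∈ J.powerset, ∑ k ∈ β, G k (β.erase k) = ∑ β ∈ J.powerset, ∑ k ∈ J \ β, G k β := by
  rw [sum_sigma', sum_sigma']
  refine sum_bij' (fun p _ => ⟨p.1.erase p.2, p.2⟩) (fun p _ => ⟨insert p.2 p.1, p.2⟩)
    ?_ ?_ ?_ ?_ fun _ _ => rfl
  · rintro ⟨β, k⟩ hp
    obtain ⟨hβ, hk⟩ := mem_sigma.1 hp
    rw [mem_powerset] at hβ
    simp only [mem_sigma, mem_powerset, mem_sdiff, mem_erase]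
    exact ⟨(erase_subset _ _).trans hβ, hβ hk, by simp⟩
  · rintro ⟨β, k⟩ hp
    simp only [mem_sigma, mem_powerset, mem_sdiff] at hp ⊢
    exact ⟨insert_subset hp.2.1 hp.1, mem_insert_self _ _⟩
  · rintro ⟨β, k⟩ hp
    simp only [insert_erase (mem_sigma.1 hp).2]
  · rintro ⟨β, k⟩ hp
    simp only [mem_sigma, mem_powerset, mem_sdiff] at hp
    simp only [erase_insert hp.2.2]

theorem sum_sum_powerset_erase (I : Finset ι) (G : ι → Finset ι → M) :
    ∑ i ∈ I, ∑ α ∈ (I.erase i).powerset, G i α =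
      ∑ α ∈ I.powerset, ∑ i ∈ α, G i (α.erase i) := by
  rw [sum_powerset_sum_mem]
  refine sum_comm' fun i α => ?_
  simp only [mem_powerset, mem_sdiff, subset_erase]
  tauto

end PowersetSums

section IzerginFinset

theorem exists_univ_map_eq {ι : Type*} (s : Finset ι) :
    ∃ (n : ℕ) (p : Fin n ↪ ι), univ.map p = s :=
  ⟨#s, s.equivFin.symm.toEmbedding.trans (Function.Embedding.subtype _), by
    rw [← map_map, map_univ_equiv, ← attach_eq_univ, attach_map_val]⟩

theorem exists_perm_eq_comp {ι : Type*} {n : ℕ} {p q : Fin n → ι} (hp : Function.Injective p)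
    (hq : Function.Injective q) (hpq : Set.range p = Set.range q) :
    ∃ σ : Equiv.Perm (Fin n), q = p ∘ σ :=
  ⟨((Equiv.ofInjective q hq).trans (Equiv.setCongr hpq.symm)).trans (Equiv.ofInjective p hp).symm,
    funext fun i => by simp [Equiv.apply_ofInjective_symm hp]⟩

variable {ι κ : Type*} [LinearOrder ι] [LinearOrder κ] {c : ℂ} {u : ι → ℂ} {v : κ → ℂ} {n : ℕ}

/-- The domain wall partition function `K(v_β|u_α)` of the variables indexed by two finite sets,
extended by zero to sets of different cardinalities. -/
def KSet (c : ℂ) (u : ι → ℂ) (v : κ → ℂ) (β : Finset κ) (α : Finset ι) : ℂ :=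
  if hc : #β = #α then
    K c (fun i => v (β.orderEmbOfFin hc i)) (fun i => u (α.orderEmbOfFin rfl i)) else 0

theorem KSet_of_card_ne {β : Finset κ} {α : Finset ι} (hcard : #β ≠ #α) : KSet c u v β α = 0 :=
  dif_neg hcard

theorem KSet_map (p : Fin n ↪ κ) (q : Fin n ↪ ι) :
    KSet c u v (univ.map p) (univ.map q) = K c (v ∘ p) (u ∘ q) := by
  have KSet_eq {m : ℕ} {β : Finset κ} {α : Finset ι} (hβ : #β = m) (hα : #α = m) :
      KSet c u v β α = K c (v ∘ β.orderEmbOfFin hβ) (u ∘ α.orderEmbOfFin hα) := by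
    subst hα
    exact dif_pos hβ
  have hp : #(univ.map p) = n := by simp
  have hq : #(univ.map q) = n := by simp
  obtain ⟨σ, hσ⟩ := exists_perm_eq_comp ((univ.map p).orderEmbOfFin hp).injective p.injective
    (by simp)
  obtain ⟨τ, hτ⟩ := exists_perm_eq_comp ((univ.map q).orderEmbOfFin hq).injective q.injective
    (by simp)
  rw [KSet_eq hp hq, hσ, hτ]
  exact (K_comp_perm _ _ σ τ).symm

theorem KSet_empty : KSet c u v ∅ ∅ = 1 := by
  simpa [K] using KSet_map (c := c) (u := u) (v := v)
    (Function.Embedding.ofIsEmpty : Fin 0 ↪ κ) (Function.Embedding.ofIsEmpty : Fin 0 ↪ ι)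

theorem KSet_insert (hc : c ≠ 0) (hu : Function.Injective u) (hv : Function.Injective v)
    (huv : ∀ i j, u i ≠ v j) (hvu : ∀ j i, h c (v j) (u i) ≠ 0)
    {j : κ} {β : Finset κ} (hj : j ∉ β) (α : Finset ι) :
    KSet c u v (insert j β) α = ∑ i ∈ α, g c (v j) (u i) * (∏ i' ∈ α.erase i, f c (u i) (u i')) *
      (∏ l ∈ β, f c (v l) (u i)) * KSet c u v β (α.erase i) := by
  by_cases hcard : #α = #β + 1
  · obtain ⟨n, p, rfl⟩ := exists_univ_map_eq β
    obtain ⟨m, q, rfl⟩ := exists_univ_map_eq α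
    obtain rfl : m = n + 1 := by simpa using hcard
    have insert_eq : insert j (univ.map p) =
        univ.map ⟨Fin.cons j p, Fin.cons_injective_iff.2 ⟨by simpa using hj, p.injective⟩⟩ := by
      ext l
      simp [Fin.exists_fin_succ, eq_comm]
    have erase_eq (i : Fin (n + 1)) : (univ.map q).erase (q i) =
        univ.map (i.succAboveEmb.trans q) := by
      rw [← map_map, ← map_erase]
      congr 1
      ext l
      simp [Fin.exists_succAbove_eq_iff]
    rw [insert_eq, KSet_map, K_succ hc _ _ (hv.comp (Function.Embedding.injective _))
      (hu.comp q.injective) (fun _ _ => (huv _ _).symm) fun _ _ => hvu _ _, sum_map]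
    refine sum_congr rfl fun i _ => ?_
    rw [erase_eq, KSet_map, prod_map, prod_map]
    rfl
  · have hinsert : #(insert j β) ≠ #α := by
      rw [card_insert_of_notMem hj]
      exact Ne.symm hcard
    rw [KSet_of_card_ne hinsert, sum_eq_zero]
    intro i hi
    rw [KSet_of_card_ne, mul_zero]
    rw [card_erase_of_mem hi]
    have := card_pos.2 ⟨i, hi⟩
    omega

end IzerginFinset

section Commutation

variable {A : Type*} [Ring A] [Algebra ℂ A] {c : ℂ} {T : Fin 3 → Fin 3 → ℂ → A}

theorem IsRTT.mul_sub_mul_eq (hT : IsRTT c T) {i j k l : Fin 3} {x y : ℂ} (hxy : x ≠ y)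
    (hi : i ≠ 2) (hk : k ≠ 2) (hl : l ≠ 2) :
    T i j x * T k l y - T k l y * T i j x = g c x y • (T k j y * T i l x - T k j x * T i l y) := by
  simpa [parity, hi, hk, hl] using hT i j k l x y hxy

theorem IsRTT.even_add_smul (hT : IsRTT c T) {a b : Fin 3} (ha : a ≠ 2) (hb : b ≠ 2) {x z : ℂ}
    (hxz : x ≠ z) :
    T b 2 x * T a 1 z + g c x z • (T a 2 x * T b 1 z) =
      T a 1 z * T b 2 x + g c x z • (T a 2 z * T b 1 x) := by
  linear_combination (norm := module) hT.mul_sub_mul_eq hxz hb ha (j := 2) (l := 1) (by decide)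

theorem IsRTT.odd_add_smul (hT : IsRTT c T) (hc : c ≠ 0) {a b : Fin 3} (ha : a ≠ 2) (hb : b ≠ 2)
    {x z : ℂ} (hxz : x ≠ z) :
    T b 2 x * T a 2 z + g c x z • (T a 2 x * T b 2 z) =
      (g c x z * h c z x) • (T a 2 z * T b 2 x) := by
  have anticommutation : T b 2 x * T a 2 z + T a 2 z * T b 2 x =
      g c x z • (T a 2 z * T b 2 x - T a 2 x * T b 2 z) := by
    simpa [parity, ha, hb] using hT b 2 a 2 x z hxz
  rw [g_mul_h_swap hc hxz]
  linear_combination (norm := module) anticommutation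

theorem IsRTT.f_smul_odd_mul_odd (hT : IsRTT c T) (hc : c ≠ 0) {a : Fin 3} (ha : a ≠ 2) {x z : ℂ}
    (hxz : x ≠ z) :
    f c x z • (T a 2 x * T a 2 z) = (g c x z * h c z x) • (T a 2 z * T a 2 x) := by
  rw [← hT.odd_add_smul hc ha ha hxz, f, add_smul, one_smul]

theorem IsRTT.commute_same (hT : IsRTT c T) {i j : Fin 3} (hi : i ≠ 2) (hj : j ≠ 2) (x y : ℂ) :
    Commute (T i j x) (T i j y) := by
  rcases eq_or_ne x y with rfl | hxy
  · exact Commute.refl _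
  have relation_xy := hT.mul_sub_mul_eq hxy hi hi hj (j := j)
  have relation_yx := hT.mul_sub_mul_eq hxy.symm hi hi hj (j := j)
  rw [g_swap c x y] at relation_yx
  have two_smul_eq : (2 : ℂ) • (T i j x * T i j y - T i j y * T i j x) = 0 := by
    linear_combination (norm := module) relation_xy - relation_yx
  exact sub_eq_zero.1 ((smul_eq_zero.1 two_smul_eq).resolve_left two_ne_zero)

theorem IsRTT.T11_mul_T01 (hT : IsRTT c T) {x y : ℂ} (hxy : x ≠ y) :
    T 1 1 x * T 0 1 y = f c x y • (T 0 1 y * T 1 1 x) - g c x y • (T 0 1 x * T 1 1 y) := by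
  rw [f]
  linear_combination (norm := module)
    hT.mul_sub_mul_eq hxy (i := 1) (j := 1) (k := 0) (l := 1) (by decide) (by decide) (by decide)

end Commutation

section OrderedProducts

variable {A : Type*} [Ring A] {ι : Type*} [LinearOrder ι] {O : ℂ → A} {w : ι → ℂ} {s : Finset ι}
  {k : ι}

theorem opProd_eq_noncommProd
    (hs : (s : Set ι).Pairwise (Function.onFun Commute fun k => O (w k))) :
    opProd O w s = s.noncommProd (fun k => O (w k)) hs := by
  have coe_eq {l : List A} {m : Multiset A} (hm) (hlm : (l : Multiset A) = m) :
      l.prod = m.noncommProd hm := by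
    subst hlm
    exact (Multiset.noncommProd_coe _ _).symm
  exact coe_eq _ (by rw [← Multiset.map_coe, sort_eq])

theorem opProd_empty (O : ℂ → A) (w : ι → ℂ) : opProd O w ∅ = 1 := by
  simp [opProd]

theorem mul_opProd (hO : ∀ x y, Commute (O x) (O y)) (hk : k ∉ s) :
    O (w k) * opProd O w s = opProd O w (insert k s) := by
  have pairwise (t : Finset ι) : (t : Set ι).Pairwise (Function.onFun Commute fun k => O (w k)) :=
    fun _ _ _ _ _ => hO _ _
  rw [opProd_eq_noncommProd (pairwise s), opProd_eq_noncommProd (pairwise (insert k s)),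
    noncommProd_insert_of_notMem _ _ _ _ hk]

theorem opProd_mul (hO : ∀ x y, Commute (O x) (O y)) (hk : k ∉ s) :
    opProd O w s * O (w k) = opProd O w (insert k s) := by
  have pairwise (t : Finset ι) : (t : Set ι).Pairwise (Function.onFun Commute fun k => O (w k)) :=
    fun _ _ _ _ _ => hO _ _
  rw [opProd_eq_noncommProd (pairwise s), opProd_eq_noncommProd (pairwise (insert k s)),
    noncommProd_insert_of_notMem' _ _ _ _ hk]

variable [Algebra ℂ A] {c : ℂ}

theorem symProd_empty (c : ℂ) (O : ℂ → A) (w : ι → ℂ) : symProd c O w ∅ = 1 := by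
  simp [symProd, opProd]

theorem mul_symProd_of_min (hw : ∀ j k, j ≠ k → h c (w j) (w k) ≠ 0) (hk : ∀ l ∈ s, k < l) :
    O (w k) * symProd c O w s = (∏ l ∈ s, h c (w l) (w k)) • symProd c O w (insert k s) := by
  have hks : k ∉ s := fun hm => (hk k hm).false
  have prod_h_ne_zero : ∏ l ∈ s, h c (w l) (w k) ≠ 0 :=
    prod_ne_zero_iff.2 fun l hl => hw _ _ (hk l hl).ne'
  have filter_lt_min : (insert k s).filter (· < k) = ∅ :=
    filter_eq_empty_iff.2 fun l hl => (forall_mem_insert k s (fun l => ¬l < k)).2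
      ⟨lt_irrefl k, fun l hl => (hk l hl).not_gt⟩ l hl
  have norm_insert : ∏ l ∈ insert k s, ∏ m ∈ (insert k s).filter (· < l), h c (w l) (w m) =
      (∏ l ∈ s, h c (w l) (w k)) * ∏ l ∈ s, ∏ m ∈ s.filter (· < l), h c (w l) (w m) := by
    rw [prod_insert hks, filter_lt_min, prod_empty, one_mul, ← prod_mul_distrib]
    refine prod_congr rfl fun l hl => ?_
    rw [filter_insert, if_pos (hk l hl), prod_insert fun hm => hks (mem_filter.1 hm).1]
  have opProd_insert_min : opProd O w (insert k s) = O (w k) * opProd O w s := by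
    rw [opProd, sort_insert _ (fun b hb => (hk b hb).le) hks, List.map_cons, List.prod_cons,
      opProd]
  rw [symProd, symProd, opProd_insert_min, norm_insert, mul_inv, smul_smul,
    mul_inv_cancel_left₀ prod_h_ne_zero, mul_smul_comm]

theorem mul_symProd (hw : ∀ j k, j ≠ k → h c (w j) (w k) ≠ 0)
    (hO : ∀ j k, j ≠ k →
      h c (w j) (w k) • (O (w j) * O (w k)) = h c (w k) (w j) • (O (w k) * O (w j)))
    (hk : k ∉ s) :
    O (w k) * symProd c O w s = (∏ l ∈ s, h c (w l) (w k)) • symProd c O w (insert k s) := by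
  induction s using Finset.induction_on_min with
  | empty => exact mul_symProd_of_min hw (by simp)
  | insert m s hm ih =>
    obtain ⟨hkm, hks⟩ : k ≠ m ∧ k ∉ s := by simpa using hk
    have hms : m ∉ s := fun h' => (hm m h').false
    rcases lt_or_gt_of_ne hkm with hlt | hlt
    · exact mul_symProd_of_min hw
        ((forall_mem_insert m s _).2 ⟨hlt, fun l hl => hlt.trans (hm l hl)⟩)
    have extract_m := mul_symProd_of_min (O := O) hw hm
    have extract_m_insert := mul_symProd_of_min (O := O) hw
      ((forall_mem_insert k s (m < ·)).2 ⟨hlt, hm⟩)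
    rw [insert_comm, prod_insert hks] at extract_m_insert
    rw [prod_insert hms]
    have scalar_ne_zero : h c (w k) (w m) * ∏ l ∈ s, h c (w l) (w m) ≠ 0 :=
      mul_ne_zero (hw _ _ hkm) (prod_ne_zero_iff.2 fun l hl => hw _ _ (hm l hl).ne')
    refine smul_right_injective A scalar_ne_zero ?_
    calc (h c (w k) (w m) * ∏ l ∈ s, h c (w l) (w m)) • (O (w k) * symProd c O w (insert m s))
        = h c (w k) (w m) • (O (w k) * ((∏ l ∈ s, h c (w l) (w m)) •
            symProd c O w (insert m s))) := by rw [mul_smul_comm, smul_smul]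
      _ = (h c (w k) (w m) • (O (w k) * O (w m))) * symProd c O w s := by
          rw [← extract_m, smul_mul_assoc, mul_assoc]
      _ = h c (w m) (w k) • (O (w m) * (O (w k) * symProd c O w s)) := by
          rw [hO k m hkm, smul_mul_assoc, mul_assoc]
      _ = _ := by
          rw [ih hks, mul_smul_comm, extract_m_insert]
          module

end OrderedProducts

section SymmetricProducts

variable {A : Type*} [Ring A] [Algebra ℂ A] {c : ℂ} {T : Fin 3 → Fin 3 → ℂ → A}
  {κ : Type*} [LinearOrder κ] {v : κ → ℂ}

theorem IsRTT.mul_symProd (hT : IsRTT c T) (hc : c ≠ 0) (hv : Function.Injective v)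
    (hvv : ∀ j k, j ≠ k → h c (v j) (v k) ≠ 0) {a : Fin 3} (ha : a ≠ 2) {j : κ} {β : Finset κ}
    (hj : j ∉ β) :
    T a 2 (v j) * symProd c (T a 2) v β =
      (∏ l ∈ β, h c (v l) (v j)) • symProd c (T a 2) v (insert j β) := by
  refine GL21.mul_symProd hvv (fun j k hjk => ?_) hj
  have hg : g c (v j) (v k) ≠ 0 := div_ne_zero hc (sub_ne_zero.2 (hv.ne hjk))
  refine smul_right_injective A hg ?_
  simpa only [smul_smul, f_eq_g_mul_h hc (hv.ne hjk)] using
    hT.f_smul_odd_mul_odd hc ha (hv.ne hjk)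

theorem IsRTT.smul_T02_mul_T02_sub (hT : IsRTT c T) (hc : c ≠ 0) {x y z : ℂ} (hxy : x ≠ y)
    (hyz : y ≠ z) (hxz : x ≠ z) (W : A) :
    (g c x z * (g c x y * h c y x)) • (T 0 2 y * (T 0 2 x * W)) -
        (g c x y * g c y z) • (T 0 2 x * (T 0 2 y * W)) =
      (g c x z * f c z y) • (T 0 2 x * (T 0 2 y * W)) := by
  rw [mul_smul, ← mul_assoc, ← mul_assoc, ← smul_mul_assoc (g c x y * h c y x),
    ← hT.f_smul_odd_mul_odd hc (by decide) hxy, smul_mul_assoc, smul_smul, ← sub_smul]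
  congr 1
  simp only [f, g_swap c y z]
  linear_combination -g_mul_g (c := c) hxy hyz hxz

theorem IsRTT.T12_mul_symProd_insert (hT : IsRTT c T) (hc : c ≠ 0) (hv : Function.Injective v)
    (hvv : ∀ j k, j ≠ k → h c (v j) (v k) ≠ 0) {j k : κ} (hjk : j ≠ k) {β : Finset κ}
    (hk : k ∉ β) :
    (∏ l ∈ β, h c (v l) (v k)) • (T 1 2 (v j) * symProd c (T 0 2) v (insert k β)) =
      (g c (v j) (v k) * h c (v k) (v j)) •
          (T 0 2 (v k) * (T 1 2 (v j) * symProd c (T 0 2) v β)) -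
        g c (v j) (v k) • (T 0 2 (v j) * (T 1 2 (v k) * symProd c (T 0 2) v β)) := by
  have exchange := hT.odd_add_smul hc (a := 0) (b := 1) (by decide) (by decide) (hv.ne hjk)
  rw [← mul_smul_comm, ← hT.mul_symProd hc hv hvv (by decide) hk, ← mul_assoc, ← mul_assoc,
    ← mul_assoc, ← smul_mul_assoc (_ * _), ← exchange, add_mul, smul_mul_assoc,
    add_sub_cancel_right]

theorem IsRTT.smul_T02_mul_symProd_insert (hT : IsRTT c T) (hc : c ≠ 0)
    (hv : Function.Injective v) (hvv : ∀ j k, j ≠ k → h c (v j) (v k) ≠ 0) {j k m : κ}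
    (hjk : j ≠ k) (hjm : j ≠ m) (hkm : k ≠ m) {γ : Finset κ} (hk : k ∉ γ) (W : A) :
    ((h c (v m) (v k) * ∏ l ∈ γ, h c (v l) (v k)) * (g c (v j) (v m) * g c (v m) (v k))) •
        (T 0 2 (v j) * (symProd c (T 0 2) v (insert k γ) * W)) =
      (g c (v j) (v k) * h c (v k) (v j) * g c (v j) (v m)) •
          (T 0 2 (v k) * (T 0 2 (v j) * (symProd c (T 0 2) v γ * W))) -
        (g c (v j) (v k) * g c (v k) (v m)) •
          (T 0 2 (v j) * (T 0 2 (v k) * (symProd c (T 0 2) v γ * W))) := by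
  have extract : T 0 2 (v k) * (symProd c (T 0 2) v γ * W) =
      (∏ l ∈ γ, h c (v l) (v k)) • (symProd c (T 0 2) v (insert k γ) * W) := by
    rw [← mul_assoc, hT.mul_symProd hc hv hvv (by decide) hk, smul_mul_assoc]
  have exchange := hT.smul_T02_mul_T02_sub hc (hv.ne hjk) (hv.ne hkm) (hv.ne hjm)
    (symProd c (T 0 2) v γ * W)
  rw [f_eq_g_mul_h hc (hv.ne hkm.symm)] at exchange
  rw [extract, mul_smul_comm] at exchange
  rw [extract, mul_smul_comm]
  linear_combination (norm := module) -exchange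

theorem IsRTT.T12_mul_symProd (hT : IsRTT c T) (hc : c ≠ 0) (hv : Function.Injective v)
    (hvv : ∀ j k, j ≠ k → h c (v j) (v k) ≠ 0) {j : κ} {β : Finset κ} (hj : j ∉ β) :
    T 1 2 (v j) * symProd c (T 0 2) v β =
      (∏ l ∈ β, (g c (v j) (v l) * h c (v l) (v j))) • (symProd c (T 0 2) v β * T 1 2 (v j)) -
      ∑ k ∈ β, (g c (v j) (v k) * ∏ l ∈ β.erase k, g c (v k) (v l)) •
        (T 0 2 (v j) * (symProd c (T 0 2) v (β.erase k) * T 1 2 (v k))) := by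
  induction β using Finset.induction_on generalizing j with
  | empty => simp [symProd_empty]
  | insert k β hk ih =>
    obtain ⟨hjk, hjβ⟩ : j ≠ k ∧ j ∉ β := by simpa using hj
    have hne {m : κ} (hm : m ∈ β) : k ≠ m := fun e => hk (e ▸ hm)
    have prod_h_ne_zero : ∏ l ∈ β, h c (v l) (v k) ≠ 0 :=
      prod_ne_zero_iff.2 fun l hl => hvv _ _ (hne hl).symm
    refine smul_right_injective A prod_h_ne_zero ?_
    have terms : (∏ l ∈ β, h c (v l) (v k)) •
          ∑ m ∈ β, (g c (v j) (v m) * ∏ l ∈ (insert k β).erase m, g c (v m) (v l)) •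
            (T 0 2 (v j) * (symProd c (T 0 2) v ((insert k β).erase m) * T 1 2 (v m))) =
        (g c (v j) (v k) * h c (v k) (v j)) • (T 0 2 (v k) *
          ∑ m ∈ β, (g c (v j) (v m) * ∏ l ∈ β.erase m, g c (v m) (v l)) •
            (T 0 2 (v j) * (symProd c (T 0 2) v (β.erase m) * T 1 2 (v m)))) -
        g c (v j) (v k) • (T 0 2 (v j) *
          ∑ m ∈ β, (g c (v k) (v m) * ∏ l ∈ β.erase m, g c (v m) (v l)) •
            (T 0 2 (v k) * (symProd c (T 0 2) v (β.erase m) * T 1 2 (v m)))) := by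
      simp only [mul_sum, smul_sum, mul_smul_comm, smul_smul]
      rw [← sum_sub_distrib]
      refine sum_congr rfl fun m hm => ?_
      have hkm : k ∉ β.erase m := fun h' => hk (mem_of_mem_erase h')
      rw [erase_insert_of_ne (hne hm), prod_insert hkm, ← mul_prod_erase β _ hm]
      linear_combination (norm := module) (∏ l ∈ β.erase m, g c (v m) (v l)) •
        hT.smul_T02_mul_symProd_insert hc hv hvv hjk (fun e : j = m => hjβ (e ▸ hm)) (hne hm) hkm
          (T 1 2 (v m))
    dsimp only
    rw [hT.T12_mul_symProd_insert hc hv hvv hjk hk, ih hjβ, ih hk, smul_sub, sum_insert hk,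
      erase_insert hk, smul_add, terms, prod_insert hk, mul_sub, mul_sub, mul_smul_comm,
      mul_smul_comm, ← mul_assoc (T 0 2 (v k)), hT.mul_symProd hc hv hvv (by decide) hk,
      smul_mul_assoc, prod_mul_distrib (s := β) (f := fun l => g c (v k) (v l))]
    module

end SymmetricProducts

section RationalIdentities

variable {c w x y z : ℂ}

theorem f_mul_g_right (hxy : x ≠ y) (hzy : z ≠ y) (hxz : x ≠ z) :
    f c x z * g c z y = g c x z * g c x y + f c x y * g c z y := by
  simp only [f]
  linear_combination g_mul_g (c := c) hxz hzy hxy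

theorem f_mul_f_mul_g (hxy : x ≠ y) (hzy : z ≠ y) (hxz : x ≠ z) :
    f c x z * (f c z y * g c x y) = g c x y + g c x z * (f c x y * g c z y) := by
  simp only [f]
  linear_combination -g_mul_g (c := c) hxz hzy hxy

theorem f_mul_g_left (hxy : x ≠ y) (hzy : z ≠ y) (hxz : x ≠ z) :
    f c x z * g c x y = g c x y * f c y z + g c x z * g c z y := by
  simp only [f, g_swap c y z]
  linear_combination -g_mul_g (c := c) hxy hzy.symm hxz

theorem g_mul_h_mul_g_sub (hc : c ≠ 0) (hxz : x ≠ z) (hwx : w ≠ x) (hwz : w ≠ z) :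
    g c x z * h c z x * g c w z - g c x z * g c w x = -(f c w x * g c w z) := by
  rw [g_mul_h_swap hc hxz, f]
  linear_combination -g_mul_g (c := c) hwx hxz hwz

theorem f_mul_g_mul_g_mul_f_add_swap (hxy : x ≠ y) (hzy : z ≠ y) (hxw : x ≠ w) (hzw : z ≠ w)
    (hyw : y ≠ w) :
    f c z y * g c x y * g c z w * f c y w + f c z w * g c x w * g c z y * f c w y =
      f c x y * g c z y * g c x w * f c y w + f c x w * g c z w * g c x y * f c w y := by
  have := sub_ne_zero.2 hxy
  have := sub_ne_zero.2 hzy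
  have := sub_ne_zero.2 hxw
  have := sub_ne_zero.2 hzw
  have := sub_ne_zero.2 hyw
  have := sub_ne_zero.2 hyw.symm
  simp only [f, g]
  field_simp
  ring

end RationalIdentities

theorem sum_sum_erase_congr_of_add_swap {ι M : Type*} [DecidableEq ι] [AddCommGroup M] [Module ℂ M]
    {I : Finset ι} {F G : ι → ι → M}
    (hFG : ∀ i ∈ I, ∀ j ∈ I.erase i, F i j + F j i = G i j + G j i) :
    ∑ i ∈ I, ∑ j ∈ I.erase i, F i j = ∑ i ∈ I, ∑ j ∈ I.erase i, G i j := by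
  have two_smul_sum (H : ι → ι → M) : (2 : ℂ) • ∑ i ∈ I, ∑ j ∈ I.erase i, H i j =
      ∑ i ∈ I, ∑ j ∈ I.erase i, (H i j + H j i) := by
    have swap : ∑ i ∈ I, ∑ j ∈ I.erase i, H i j = ∑ i ∈ I, ∑ j ∈ I.erase i, H j i :=
      sum_comm' fun i j => by simp only [mem_erase, ne_comm (a := i)]; tauto
    simp only [sum_add_distrib, ← swap, two_smul]
  refine smul_right_injective M (two_ne_zero : (2 : ℂ) ≠ 0) ?_
  dsimp only
  rw [two_smul_sum, two_smul_sum]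
  exact sum_congr rfl fun i hi => sum_congr rfl (hFG i hi)

section Lowering

variable {A : Type*} [Ring A] [Algebra ℂ A] {ι : Type*} [DecidableEq ι]
  {c : ℂ} {O : ℂ → A} {u : ι → ℂ}

/-- The weighted sum over the ways to remove one variable `u_i` from `I` and to put `O (u_i)` to the
right of the remaining operator `G (I \ {i})`; it is bilinear in the weight `φ` and in `G`. -/
def lower (c : ℂ) (O : ℂ → A) (u : ι → ℂ) (I : Finset ι) :
    (ℂ → ℂ) →ₗ[ℂ] (Finset ι → A) →ₗ[ℂ] A :=
  ∑ i ∈ I, (∏ i' ∈ I.erase i, f c (u i) (u i')) •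
    (LinearMap.smulRight (LinearMap.proj (u i))
      (LinearMap.mulRight ℂ (O (u i)) ∘ₗ LinearMap.proj (I.erase i)))

theorem lower_apply (I : Finset ι) (φ : ℂ → ℂ) (G : Finset ι → A) :
    lower c O u I φ G = ∑ i ∈ I, (φ (u i) * ∏ i' ∈ I.erase i, f c (u i) (u i')) •
      (G (I.erase i) * O (u i)) := by
  simp [lower, smul_smul, mul_comm]

theorem lower_congr {I : Finset ι} {φ ψ : ℂ → ℂ} {G H : Finset ι → A}
    (hφ : ∀ i ∈ I, φ (u i) = ψ (u i)) (hG : ∀ i ∈ I, G (I.erase i) = H (I.erase i)) :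
    lower c O u I φ G = lower c O u I ψ H := by
  rw [lower_apply, lower_apply]
  exact sum_congr rfl fun i hi => by rw [hφ i hi, hG i hi]

theorem lower_empty (φ : ℂ → ℂ) (G : Finset ι → A) : lower c O u ∅ φ G = 0 := by
  simp [lower_apply]

theorem mul_lower (X : A) (I : Finset ι) (φ : ℂ → ℂ) (G : Finset ι → A) :
    X * lower c O u I φ G = lower c O u I φ fun I' => X * G I' := by
  simp only [lower_apply, mul_sum, mul_smul_comm, mul_assoc]

theorem lower_insert {a : ι} {I : Finset ι} (ha : a ∉ I) (φ : ℂ → ℂ) (G : Finset ι → A) :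
    lower c O u (insert a I) φ G = (φ (u a) * ∏ i ∈ I, f c (u a) (u i)) • (G I * O (u a)) +
      lower c O u I (fun y => f c y (u a) * φ y) fun I' => G (insert a I') := by
  rw [lower_apply, lower_apply, sum_insert ha, erase_insert ha]
  congr 1
  refine sum_congr rfl fun i hi => ?_
  have hai : a ≠ i := fun e => ha (e ▸ hi)
  rw [erase_insert_of_ne hai, prod_insert fun h' => ha (mem_of_mem_erase h')]
  congr 1
  ring

theorem lower_f_mul (hO : ∀ x y, Commute (O x) (O y)) (x : ℂ) (I : Finset ι) (φ : ℂ → ℂ)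
    (G : Finset ι → A) :
    lower c O u I (fun y => f c x y * φ y)
        (fun I' => (∏ i ∈ I', f c x (u i)) • (G I' * O x)) =
      (∏ i ∈ I, f c x (u i)) • (lower c O u I φ G * O x) := by
  simp only [lower_apply, sum_mul, smul_sum, smul_mul_assoc, smul_smul]
  refine sum_congr rfl fun i hi => ?_
  rw [mul_assoc (G _), mul_assoc (G _), (hO x (u i)).eq, ← mul_prod_erase I _ hi]
  congr 1
  ring

theorem lower_f_mul_g {I : Finset ι} {x z : ℂ} (hxz : x ≠ z) (hx : ∀ i ∈ I, x ≠ u i)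
    (hz : ∀ i ∈ I, z ≠ u i) (φ : ℂ → ℂ) (G : Finset ι → A) :
    lower c O u I (fun y => f c y z * (g c x y * φ y)) G =
      f c x z • lower c O u I (fun y => g c x y * φ y) G -
        g c x z • lower c O u I (fun y => g c z y * φ y) G := by
  simp only [← LinearMap.map_smul₂, ← LinearMap.map_sub₂]
  refine lower_congr (fun i hi => ?_) fun _ _ => rfl
  simp only [Pi.sub_apply, Pi.smul_apply, smul_eq_mul]
  linear_combination -φ (u i) * f_mul_g_left (c := c) (hx i hi) (hz i hi) hxz

theorem lower_lower_exchange (hO : ∀ x y, Commute (O x) (O y)) (hu : Function.Injective u)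
    {I : Finset ι} {x z : ℂ} (hx : ∀ i ∈ I, x ≠ u i) (hz : ∀ i ∈ I, z ≠ u i) (φ : ℂ → ℂ)
    (G : Finset ι → A) :
    lower c O u I (fun y => g c x y * (f c z y * φ y))
        (fun I' => lower c O u I' (fun y => g c z y * φ y) G) =
      lower c O u I (fun y => g c z y * (f c x y * φ y))
        (fun I' => lower c O u I' (fun y => g c x y * φ y) G) := by
  simp only [lower_apply, sum_mul, smul_sum, smul_mul_assoc, smul_smul]
  refine sum_sum_erase_congr_of_add_swap fun i hi j hj => ?_
  obtain ⟨hji, hj⟩ := mem_erase.1 hj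
  have hji' : j ∈ I.erase i := mem_erase.2 ⟨hji, hj⟩
  have hij' : i ∈ I.erase j := mem_erase.2 ⟨hji.symm, hi⟩
  rw [erase_right_comm (a := j), mul_assoc (G _), mul_assoc (G _), (hO (u i) (u j)).eq,
    ← mul_prod_erase _ _ hji', ← mul_prod_erase _ _ hij', erase_right_comm (a := j),
    ← add_smul, ← add_smul]
  congr 1
  linear_combination φ (u i) * φ (u j) * (∏ l ∈ (I.erase i).erase j, f c (u i) (u l)) *
    (∏ l ∈ (I.erase i).erase j, f c (u j) (u l)) *
    f_mul_g_mul_g_mul_f_add_swap (c := c) (hx i hi) (hz i hi) (hx j hj) (hz j hj)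
      (hu.ne hji.symm)

end Lowering

section Dressing

variable {A : Type*} [Ring A] [Algebra ℂ A] {ι : Type*} [DecidableEq ι]
  {c : ℂ} {T : Fin 3 → Fin 3 → ℂ → A} {u : ι → ℂ}

/-- The operator `T_{2j}(x)` (in the indices `1, 2, 3` of the paper) together with the contribution
of `T_{1j}(x)`, which lowers the set of variables `u_I` by one element with weight `g(x, ·) φ`. -/
def dressed (c : ℂ) (T : Fin 3 → Fin 3 → ℂ → A) (u : ι → ℂ) (j : Fin 3) (x : ℂ) (φ : ℂ → ℂ) :
    (Finset ι → A) →ₗ[ℂ] Finset ι → A where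
  toFun G I := T 1 j x * G I + T 0 j x * lower c (T 1 1) u I (fun y => g c x y * φ y) G
  map_add' G H := by
    funext I
    simp only [map_add, Pi.add_apply, mul_add]
    abel
  map_smul' r G := by
    funext I
    simp only [map_smul, Pi.smul_apply, mul_smul_comm, RingHom.id_apply, smul_add]

theorem dressed_apply (j : Fin 3) (x : ℂ) (φ : ℂ → ℂ) (G : Finset ι → A) (I : Finset ι) :
    dressed c T u j x φ G I =
      T 1 j x * G I + T 0 j x * lower c (T 1 1) u I (fun y => g c x y * φ y) G :=
  rfl

theorem dressed_congr {j : Fin 3} {x : ℂ} {φ : ℂ → ℂ} {G H : Finset ι → A} {I : Finset ι}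
    (hGH : ∀ I' ⊆ I, G I' = H I') : dressed c T u j x φ G I = dressed c T u j x φ H I := by
  rw [dressed_apply, dressed_apply, hGH I subset_rfl,
    lower_congr (fun _ _ => rfl) fun i _ => hGH _ (erase_subset i I)]

theorem dressed_f_mul (hT : ∀ x y, Commute (T 1 1 x) (T 1 1 y)) (j : Fin 3) (w x : ℂ) (φ : ℂ → ℂ)
    (G : Finset ι → A) (I : Finset ι) :
    dressed c T u j x (fun y => f c w y * φ y)
        (fun I' => (∏ i ∈ I', f c w (u i)) • (G I' * T 1 1 w)) I =
      (∏ i ∈ I, f c w (u i)) • (dressed c T u j x φ G I * T 1 1 w) := by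
  simp only [dressed_apply, mul_left_comm (g c x _), lower_f_mul hT]
  rw [mul_smul_comm, mul_smul_comm, ← smul_add, add_mul, mul_assoc, mul_assoc]

theorem dressed_dressed (i j : Fin 3) (x z : ℂ) (φ ψ : ℂ → ℂ) (G : Finset ι → A) (I : Finset ι) :
    dressed c T u i x φ (dressed c T u j z ψ G) I =
      T 1 i x * T 1 j z * G I +
      T 1 i x * T 0 j z * lower c (T 1 1) u I (fun y => g c z y * ψ y) G +
      T 0 i x * T 1 j z * lower c (T 1 1) u I (fun y => g c x y * φ y) G +
      T 0 i x * T 0 j z * lower c (T 1 1) u I (fun y => g c x y * φ y)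
        (fun I' => lower c (T 1 1) u I' (fun y => g c z y * ψ y) G) := by
  have expand_inner : lower c (T 1 1) u I (fun y => g c x y * φ y) (dressed c T u j z ψ G) =
      T 1 j z * lower c (T 1 1) u I (fun y => g c x y * φ y) G +
      T 0 j z * lower c (T 1 1) u I (fun y => g c x y * φ y)
        (fun I' => lower c (T 1 1) u I' (fun y => g c z y * ψ y) G) := by
    rw [mul_lower, mul_lower, ← map_add]
    rfl
  rw [dressed_apply, expand_inner, dressed_apply]
  simp only [mul_add, mul_assoc, add_assoc]

theorem f_smul_dressed_dressed (hT : ∀ x y, Commute (T 1 1 x) (T 1 1 y))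
    (hu : Function.Injective u) {I : Finset ι} {x z : ℂ} (hxz : x ≠ z) (hx : ∀ i ∈ I, x ≠ u i)
    (hz : ∀ i ∈ I, z ≠ u i) (i j : Fin 3) (φ : ℂ → ℂ) (G : Finset ι → A) :
    f c x z • dressed c T u i x (fun y => f c z y * φ y) (dressed c T u j z φ G) I =
      (T 1 i x * T 1 j z + g c x z • (T 1 i x * T 1 j z)) * G I +
      (T 0 i x * T 1 j z + g c x z • (T 1 i x * T 0 j z)) *
        lower c (T 1 1) u I (fun y => g c x y * φ y) G +
      (T 1 i x * T 0 j z + g c x z • (T 0 i x * T 1 j z)) *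
        lower c (T 1 1) u I (fun y => g c z y * (f c x y * φ y)) G +
      (T 0 i x * T 0 j z + g c x z • (T 0 i x * T 0 j z)) *
        lower c (T 1 1) u I (fun y => g c z y * (f c x y * φ y))
          (fun I' => lower c (T 1 1) u I' (fun y => g c x y * φ y) G) := by
  have single_T1 : f c x z • lower c (T 1 1) u I (fun y => g c z y * φ y) G =
      g c x z • lower c (T 1 1) u I (fun y => g c x y * φ y) G +
        lower c (T 1 1) u I (fun y => g c z y * (f c x y * φ y)) G := by
    simp only [← LinearMap.map_smul₂, ← LinearMap.map_add₂]
    refine lower_congr (fun i hi => ?_) fun _ _ => rfl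
    simp only [Pi.add_apply, Pi.smul_apply, smul_eq_mul]
    linear_combination φ (u i) * f_mul_g_right (c := c) (hx i hi) (hz i hi) hxz
  have single_T0 : f c x z • lower c (T 1 1) u I (fun y => g c x y * (f c z y * φ y)) G =
      lower c (T 1 1) u I (fun y => g c x y * φ y) G +
        g c x z • lower c (T 1 1) u I (fun y => g c z y * (f c x y * φ y)) G := by
    simp only [← LinearMap.map_smul₂, ← LinearMap.map_add₂]
    refine lower_congr (fun i hi => ?_) fun _ _ => rfl
    simp only [Pi.add_apply, Pi.smul_apply, smul_eq_mul]
    linear_combination φ (u i) * f_mul_f_mul_g (c := c) (hx i hi) (hz i hi) hxz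
  have cross_T1 := congrArg (fun W => T 1 i x * (T 0 j z * W)) single_T1
  have cross_T0 := congrArg (fun W => T 0 i x * (T 1 j z * W)) single_T0
  simp only [mul_add, mul_smul_comm] at cross_T1 cross_T0
  rw [dressed_dressed, lower_lower_exchange hT hu hx hz]
  simp only [add_mul, smul_mul_assoc, mul_assoc]
  have f_eq : f c x z = 1 + g c x z := rfl
  rw [f_eq] at cross_T1 cross_T0 ⊢
  linear_combination (norm := module) cross_T1 + cross_T0

theorem IsRTT.f_smul_dressed2_dressed2 (hT : IsRTT c T) (hc : c ≠ 0) (hu : Function.Injective u)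
    {I : Finset ι} {x z : ℂ} (hxz : x ≠ z) (hx : ∀ i ∈ I, x ≠ u i) (hz : ∀ i ∈ I, z ≠ u i)
    (φ : ℂ → ℂ) (G : Finset ι → A) :
    f c x z • dressed c T u 2 x (fun y => f c z y * φ y) (dressed c T u 2 z φ G) I =
      (g c x z * h c z x) •
        dressed c T u 2 z (fun y => f c x y * φ y) (dressed c T u 2 x φ G) I := by
  rw [f_smul_dressed_dressed (hT.commute_same (by decide) (by decide)) hu hxz hx hz,
    dressed_dressed]
  have zero_ne_two : (0 : Fin 3) ≠ 2 := by decide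
  have one_ne_two : (1 : Fin 3) ≠ 2 := by decide
  rw [hT.odd_add_smul hc one_ne_two one_ne_two hxz, hT.odd_add_smul hc one_ne_two zero_ne_two hxz,
    hT.odd_add_smul hc zero_ne_two one_ne_two hxz, hT.odd_add_smul hc zero_ne_two zero_ne_two hxz]
  simp only [smul_mul_assoc, smul_add]

theorem IsRTT.dressed1_dressed2 (hT : IsRTT c T) (hu : Function.Injective u)
    {I : Finset ι} {x z : ℂ} (hxz : x ≠ z) (hx : ∀ i ∈ I, x ≠ u i) (hz : ∀ i ∈ I, z ≠ u i)
    (φ : ℂ → ℂ) (G : Finset ι → A) :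
    dressed c T u 1 z (fun y => f c x y * φ y) (dressed c T u 2 x φ G) I =
      f c x z • dressed c T u 2 x (fun y => f c z y * φ y) (dressed c T u 1 z φ G) I -
        g c x z • dressed c T u 2 z (fun y => f c x y * φ y) (dressed c T u 1 x φ G) I := by
  rw [f_smul_dressed_dressed (hT.commute_same (by decide) (by decide)) hu hxz hx hz,
    dressed_dressed, dressed_dressed]
  have zero_ne_two : (0 : Fin 3) ≠ 2 := by decide
  have one_ne_two : (1 : Fin 3) ≠ 2 := by decide
  rw [hT.even_add_smul one_ne_two one_ne_two hxz, hT.even_add_smul one_ne_two zero_ne_two hxz,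
    hT.even_add_smul zero_ne_two one_ne_two hxz, hT.even_add_smul zero_ne_two zero_ne_two hxz]
  simp only [add_mul, smul_mul_assoc, smul_add]
  abel

theorem IsRTT.dressed1_dressed2_eq_sub (hT : IsRTT c T) (hc : c ≠ 0) (hu : Function.Injective u)
    {I : Finset ι} {x z : ℂ} (hxz : x ≠ z) (hx : ∀ i ∈ I, x ≠ u i) (hz : ∀ i ∈ I, z ≠ u i)
    {φ : ℂ → ℂ} {G Z : Finset ι → A}
    (hG : ∀ I' ⊆ I, dressed c T u 1 z φ G I' =
      (φ z * ∏ i ∈ I', f c z (u i)) • (G I' * T 1 1 z) - dressed c T u 2 z φ Z I') :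
    dressed c T u 1 z (fun y => f c x y * φ y) (dressed c T u 2 x φ G) I =
      (f c x z * φ z * ∏ i ∈ I, f c z (u i)) • (dressed c T u 2 x φ G I * T 1 1 z) -
        dressed c T u 2 z (fun y => f c x y * φ y)
          ((g c x z * h c z x) • dressed c T u 2 x φ Z + g c x z • dressed c T u 1 x φ G) I := by
  have inner : dressed c T u 2 x (fun y => f c z y * φ y) (dressed c T u 1 z φ G) I =
      (φ z * ∏ i ∈ I, f c z (u i)) • (dressed c T u 2 x φ G I * T 1 1 z) -
        dressed c T u 2 x (fun y => f c z y * φ y) (dressed c T u 2 z φ Z) I := by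
    rw [dressed_congr (H := φ z • (fun I' => (∏ i ∈ I', f c z (u i)) • (G I' * T 1 1 z)) -
        dressed c T u 2 z φ Z) fun I' hI' => by rw [hG I' hI', mul_smul]; rfl,
      map_sub, map_smul, Pi.sub_apply, Pi.smul_apply,
      dressed_f_mul (hT.commute_same (by decide) (by decide)), smul_smul]
  rw [hT.dressed1_dressed2 hu hxz hx hz, inner, smul_sub,
    hT.f_smul_dressed2_dressed2 hc hu hxz hx hz, smul_smul, ← mul_assoc, sub_sub]
  simp only [map_add, map_smul, Pi.add_apply, Pi.smul_apply]

theorem IsRTT.T01_mul_dressed2 (hT : IsRTT c T) (hc : c ≠ 0) {a : ι} {I : Finset ι} {x : ℂ}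
    (hxa : x ≠ u a) (ha : a ∉ I) (hx : ∀ i ∈ I, x ≠ u i) (hau : ∀ i ∈ I, u a ≠ u i)
    {φ : ℂ → ℂ} {G Z : Finset ι → A}
    (hGZ : ∀ I' ⊆ I, T 0 1 (u a) * G I' = G (insert a I') - T 0 2 (u a) * Z I')
    (hG : dressed c T u 1 (u a) φ G I =
      (φ (u a) * ∏ i ∈ I, f c (u a) (u i)) • (G I * T 1 1 (u a)) - dressed c T u 2 (u a) φ Z I) :
    T 0 1 (u a) * dressed c T u 2 x φ G I =
      dressed c T u 2 x φ G (insert a I) - T 0 2 (u a) *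
        ((g c x (u a) * h c (u a) x) • dressed c T u 2 x φ Z I +
          g c x (u a) • dressed c T u 1 x φ G I) := by
  have G_insert {I' : Finset ι} (hI' : I' ⊆ I) :
      G (insert a I') = T 0 1 (u a) * G I' + T 0 2 (u a) * Z I' :=
    (eq_sub_iff_add_eq.1 (hGZ I' hI')).symm
  have lower_G_insert : lower c (T 1 1) u I (fun y => f c y (u a) * (g c x y * φ y))
        (fun I' => G (insert a I')) =
      T 0 1 (u a) * lower c (T 1 1) u I (fun y => f c y (u a) * (g c x y * φ y)) G +
        T 0 2 (u a) * lower c (T 1 1) u I (fun y => f c y (u a) * (g c x y * φ y)) Z := by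
    rw [mul_lower, mul_lower, ← map_add]
    exact lower_congr (fun _ _ => rfl) fun i _ => G_insert (erase_subset i I)
  have zero_ne_two : (0 : Fin 3) ≠ 2 := by decide
  have one_ne_two : (1 : Fin 3) ≠ 2 := by decide
  have even_T12 := congrArg (· * G I) (hT.even_add_smul zero_ne_two one_ne_two hxa)
  have even_T02 := congrArg (· * lower c (T 1 1) u I (fun y => g c x y * φ y) G)
    (hT.even_add_smul zero_ne_two zero_ne_two hxa)
  have odd_T12 := congrArg (· * Z I) (hT.odd_add_smul hc zero_ne_two one_ne_two hxa)
  have odd_T02 := congrArg (· * lower c (T 1 1) u I (fun y => g c x y * φ y) Z)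
    (hT.odd_add_smul hc zero_ne_two zero_ne_two hxa)
  have moved := congrArg (fun W => g c x (u a) • (T 0 2 x * W)) (eq_sub_iff_add_eq.1 hG)
  have f_eq : f c x (u a) = 1 + g c x (u a) := rfl
  simp only [dressed_apply, lower_insert ha, lower_G_insert, lower_f_mul_g hxa hx hau,
    G_insert subset_rfl, f_eq, add_mul, mul_add, mul_sub, smul_mul_assoc, mul_smul_comm,
    mul_assoc, smul_add] at even_T12 even_T02 odd_T12 odd_T02 moved ⊢
  linear_combination (norm := module) moved - even_T12 - even_T02 - odd_T12 - odd_T02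

end Dressing

section BetheVectors

/-- The function `y ↦ f(v̄_J, y)`. -/
def fProd {κ : Type*} (c : ℂ) (v : κ → ℂ) (J : Finset κ) (y : ℂ) : ℂ :=
  ∏ l ∈ J, f c (v l) y

theorem fProd_insert {κ : Type*} [DecidableEq κ] {c : ℂ} {v : κ → ℂ} {j : κ} {J : Finset κ}
    (hj : j ∉ J) :
    fProd c v (insert j J) = fun y => f c (v j) y * fProd c v J y := by
  funext y
  exact prod_insert hj

variable {A : Type*} [Ring A] [Algebra ℂ A] {ι κ : Type*} [LinearOrder ι] [LinearOrder κ]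
  {c : ℂ} {T : Fin 3 → Fin 3 → ℂ → A} {u : ι → ℂ} {v : κ → ℂ}

/-- The even factor of `Y`: the part of the sum over the partitions of `ū_I` that belongs to a fixed
subset `v̄_β` of the odd variables. -/
def izerginSum (c : ℂ) (T : Fin 3 → Fin 3 → ℂ → A) (u : ι → ℂ) (v : κ → ℂ) (β : Finset κ)
    (I : Finset ι) : A :=
  ∑ α ∈ I.powerset, (KSet c u v β α * ∏ i ∈ α, ∏ i' ∈ I \ α, f c (u i) (u i')) •
    (opProd (T 0 1) u (I \ α) * opProd (T 1 1) u α)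

theorem izerginSum_empty (I : Finset ι) :
    izerginSum c T u v ∅ I = opProd (T 0 1) u I := by
  rw [izerginSum, sum_eq_single_of_mem ∅ (empty_mem_powerset I)]
  · simp [KSet_empty, opProd_empty]
  · intro α _ hα
    rw [KSet_of_card_ne (by simpa [eq_comm] using hα), zero_mul, zero_smul]

theorem IsRTT.izerginSum_insert (hT : IsRTT c T) (hc : c ≠ 0) (hu : Function.Injective u)
    (hv : Function.Injective v) (huv : ∀ i j, u i ≠ v j) (hvu : ∀ j i, h c (v j) (u i) ≠ 0)
    {j : κ} {β : Finset κ} (hj : j ∉ β) (I : Finset ι) :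
    izerginSum c T u v (insert j β) I =
      lower c (T 1 1) u I (fun y => g c (v j) y * fProd c v β y) (izerginSum c T u v β) := by
  simp only [izerginSum, lower_apply, sum_mul, smul_sum, smul_mul_assoc, smul_smul,
    KSet_insert hc hu hv huv hvu hj, sum_smul]
  refine Eq.trans ?_ (sum_sum_powerset_erase I _).symm
  refine sum_congr rfl fun α hα => sum_congr rfl fun i hi => ?_
  have sdiff_eq : I.erase i \ α.erase i = I \ α := by
    grind
  have hαI : α.erase i ⊆ I.erase i := erase_subset_erase i (mem_powerset.1 hα)
  rw [sdiff_eq, mul_assoc (opProd _ _ _), opProd_mul (hT.commute_same (by decide) (by decide))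
    (notMem_erase i α), insert_erase hi, ← mul_prod_erase α _ hi, ← prod_sdiff hαI, sdiff_eq, fProd]
  congr 1
  ring

theorem Y_eq_sum (I : Finset ι) (J : Finset κ) :
    Y c T u v I J = ∑ β ∈ J.powerset, (∏ j ∈ J \ β, ∏ j' ∈ β, g c (v j) (v j')) •
      (symProd c (T 0 2) v β * symProd c (T 1 2) v (J \ β) * izerginSum c T u v β I) := by
  rw [Y, sum_comm]
  refine sum_congr rfl fun β _ => ?_
  rw [izerginSum, mul_sum, smul_sum]
  refine sum_congr rfl fun α _ => ?_
  rw [KSet]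
  split_ifs
  · rw [mul_smul_comm, smul_smul, mul_assoc (symProd c (T 0 2) v β * _), mul_comm]
  · rw [zero_mul, zero_smul, mul_zero, smul_zero]

theorem Y_empty (I : Finset ι) : Y c T u v I ∅ = opProd (T 0 1) u I := by
  simp [Y_eq_sum, symProd_empty, izerginSum_empty]

theorem IsRTT.prod_smul_izerginSum_insert (hT : IsRTT c T) (hc : c ≠ 0) (hu : Function.Injective u)
    (hv : Function.Injective v) (huv : ∀ i j, u i ≠ v j) (hvu : ∀ j i, h c (v j) (u i) ≠ 0)
    {j : κ} {J β : Finset κ} (hβ : β ⊆ J) (hj : j ∉ J) (I : Finset ι) :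
    (∏ l ∈ J \ β, f c (v l) (v j)) • izerginSum c T u v (insert j β) I =
      lower c (T 1 1) u I (fun y => g c (v j) y * fProd c v J y) (izerginSum c T u v β) -
        ∑ k ∈ J \ β, (g c (v j) (v k) * ∏ l ∈ (J \ β).erase k, f c (v l) (v k)) •
          izerginSum c T u v (insert k β) I := by
  rw [hT.izerginSum_insert hc hu hv huv hvu (fun h' => hj (hβ h')),
    sum_congr rfl fun k hk => by
      rw [hT.izerginSum_insert hc hu hv huv hvu (mem_sdiff.1 hk).2]]
  simp only [← LinearMap.map_smul₂, ← LinearMap.map_sum₂, ← LinearMap.map_sub₂]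
  refine lower_congr (fun i _ => ?_) fun _ _ => rfl
  simp only [Pi.sub_apply, Pi.smul_apply, Finset.sum_apply, smul_eq_mul]
  have partialFraction := prod_f_mul_g hc hv (J \ β) (x := v j) (z := u i) (huv i j).symm
    (fun l hl => hv.ne fun (e : l = j) => hj (e ▸ (mem_sdiff.1 hl).1)) fun l _ => (huv i l).symm
  have split_fProd : fProd c v J (u i) = (∏ l ∈ J \ β, f c (v l) (u i)) * fProd c v β (u i) :=
    (prod_sdiff hβ).symm
  rw [split_fProd]
  have regroup : ∑ k ∈ J \ β, g c (v k) (v j) * (∏ l ∈ (J \ β).erase k, f c (v l) (v k)) *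
        g c (v k) (u i) * fProd c v β (u i) =
      -∑ k ∈ J \ β, g c (v j) (v k) * (∏ l ∈ (J \ β).erase k, f c (v l) (v k)) *
        (g c (v k) (u i) * fProd c v β (u i)) := by
    simp only [← sum_neg_distrib, g_swap c (v j), neg_mul, mul_assoc]
  rw [← sum_mul] at regroup
  linear_combination fProd c v β (u i) * partialFraction + regroup

theorem IsRTT.smul_T02_mul_symProd_mul_T12_mul_symProd (hT : IsRTT c T) (hc : c ≠ 0)
    (hv : Function.Injective v) (hvv : ∀ j k, j ≠ k → h c (v j) (v k) ≠ 0) {j k : κ}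
    {γ δ : Finset κ} (hjγ : j ∉ γ) (hkγ : k ∉ γ) (hkδ : k ∉ δ) :
    ((∏ l ∈ δ, ∏ l' ∈ insert k γ, g c (v l) (v l')) *
        (g c (v j) (v k) * ∏ l ∈ γ, g c (v k) (v l))) •
        (T 0 2 (v j) * (symProd c (T 0 2) v γ * T 1 2 (v k)) * symProd c (T 1 2) v δ) =
      ((∏ l ∈ insert k δ, ∏ l' ∈ γ, g c (v l) (v l')) * (∏ l ∈ γ, h c (v l) (v j)) *
        (g c (v j) (v k) * ∏ l ∈ δ, f c (v l) (v k))) •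
        (symProd c (T 0 2) v (insert j γ) * symProd c (T 1 2) v (insert k δ)) := by
  rw [← mul_assoc (T 0 2 _), mul_assoc _ (T 1 2 (v k)), hT.mul_symProd hc hv hvv (by decide) hjγ,
    hT.mul_symProd hc hv hvv (by decide) hkδ, smul_mul_smul_comm, smul_smul, prod_insert hkδ,
    prod_f_eq_prod_g_mul_prod_h hc fun l hl => hv.ne (ne_of_mem_of_not_mem hl hkδ)]
  simp only [prod_insert hkγ, prod_mul_distrib]
  congr 1
  ring

theorem IsRTT.T12_mul_Y (hT : IsRTT c T) (hc : c ≠ 0) (hv : Function.Injective v)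
    (hvv : ∀ j k, j ≠ k → h c (v j) (v k) ≠ 0) {j : κ} {J : Finset κ} (hj : j ∉ J) (I : Finset ι) :
    T 1 2 (v j) * Y c T u v I J =
      ∑ β ∈ J.powerset, ((∏ l ∈ J \ β, ∏ l' ∈ β, g c (v l) (v l')) * (∏ l ∈ β, g c (v j) (v l)) *
          ∏ l ∈ J, h c (v l) (v j)) •
        (symProd c (T 0 2) v β * symProd c (T 1 2) v (insert j (J \ β)) * izerginSum c T u v β I) -
      ∑ β ∈ J.powerset, ((∏ l ∈ J \ β, ∏ l' ∈ β, g c (v l) (v l')) * ∏ l ∈ β, h c (v l) (v j)) •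
        (symProd c (T 0 2) v (insert j β) * symProd c (T 1 2) v (J \ β) *
          ∑ k ∈ J \ β, (g c (v j) (v k) * ∏ l ∈ (J \ β).erase k, f c (v l) (v k)) •
            izerginSum c T u v (insert k β) I) := by
  simp only [mul_sum, mul_smul_comm, smul_sum, smul_smul]
  rw [← sum_powerset_sum_mem J fun k β => ((∏ l ∈ J \ β, ∏ l' ∈ β, g c (v l) (v l')) *
    (∏ l ∈ β, h c (v l) (v j)) * (g c (v j) (v k) * ∏ l ∈ (J \ β).erase k, f c (v l) (v k))) •
    (symProd c (T 0 2) v (insert j β) * symProd c (T 1 2) v (J \ β) *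
      izerginSum c T u v (insert k β) I), Y_eq_sum, mul_sum, ← sum_sub_distrib]
  refine sum_congr rfl fun β hβ => ?_
  have hβJ := mem_powerset.1 hβ
  have hjβ : j ∉ β := fun h' => hj (hβJ h')
  have hjJβ : j ∉ J \ β := fun h' => hj (mem_sdiff.1 h').1
  rw [mul_smul_comm, ← mul_assoc, ← mul_assoc, hT.T12_mul_symProd hc hv hvv hjβ, sub_mul, sub_mul,
    smul_sub]
  congr 1
  · rw [smul_mul_assoc, mul_assoc (symProd _ _ _ _), hT.mul_symProd hc hv hvv (by decide) hjJβ,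
      mul_smul_comm, smul_mul_assoc, smul_mul_assoc, smul_smul, smul_smul, prod_mul_distrib,
      ← prod_sdiff hβJ]
    congr 1
    ring
  · rw [sum_mul, sum_mul, smul_sum]
    refine sum_congr rfl fun k hk => ?_
    have sdiff_erase_eq : J \ β.erase k = insert k (J \ β) := by grind
    have move_T12 := hT.smul_T02_mul_symProd_mul_T12_mul_symProd hc hv hvv (δ := J \ β)
      (fun h' => hjβ (mem_of_mem_erase h')) (notMem_erase k β) (by simp [hk])
    rw [insert_erase hk] at move_T12
    rw [smul_mul_assoc, smul_mul_assoc, smul_smul, ← smul_mul_assoc, move_T12, smul_mul_assoc,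
      sdiff_erase_eq, insert_erase hk, erase_insert (by simp [hk])]

theorem IsRTT.T02_mul_lower_Y (hT : IsRTT c T) (hc : c ≠ 0) (hv : Function.Injective v)
    (hvv : ∀ j k, j ≠ k → h c (v j) (v k) ≠ 0) {j : κ} {J : Finset κ} (hj : j ∉ J) (I : Finset ι)
    (φ : ℂ → ℂ) :
    T 0 2 (v j) * lower c (T 1 1) u I φ (fun I' => Y c T u v I' J) =
      ∑ β ∈ J.powerset, ((∏ l ∈ J \ β, ∏ l' ∈ β, g c (v l) (v l')) * ∏ l ∈ β, h c (v l) (v j)) •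
        (symProd c (T 0 2) v (insert j β) * symProd c (T 1 2) v (J \ β) *
          lower c (T 1 1) u I φ (izerginSum c T u v β)) := by
  have Y_eq : (fun I' => Y c T u v I' J) =
      ∑ β ∈ J.powerset, (∏ l ∈ J \ β, ∏ l' ∈ β, g c (v l) (v l')) • fun I' =>
        symProd c (T 0 2) v β * symProd c (T 1 2) v (J \ β) * izerginSum c T u v β I' := by
    funext I'
    simp only [Y_eq_sum, Finset.sum_apply, Pi.smul_apply]
  rw [Y_eq, map_sum, mul_sum]
  refine sum_congr rfl fun β hβ => ?_
  have hjβ : j ∉ β := fun h' => hj (mem_powerset.1 hβ h')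
  rw [map_smul, ← mul_lower, mul_smul_comm, ← mul_assoc, ← mul_assoc,
    hT.mul_symProd hc hv hvv (by decide) hjβ, smul_mul_assoc, smul_mul_assoc, smul_smul]

theorem IsRTT.prod_h_smul_Y_insert (hT : IsRTT c T) (hc : c ≠ 0) (hu : Function.Injective u)
    (hv : Function.Injective v) (huv : ∀ i j, u i ≠ v j)
    (hvv : ∀ j k, j ≠ k → h c (v j) (v k) ≠ 0) (hvu : ∀ j i, h c (v j) (u i) ≠ 0)
    {j : κ} {J : Finset κ} (hj : j ∉ J) (I : Finset ι) :
    (∏ l ∈ J, h c (v l) (v j)) • Y c T u v I (insert j J) =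
      dressed c T u 2 (v j) (fProd c v J) (fun I' => Y c T u v I' J) I := by
  rw [dressed_apply, hT.T12_mul_Y hc hv hvv hj, hT.T02_mul_lower_Y hc hv hvv hj, sub_add_eq_add_sub,
    add_sub_assoc, ← sum_sub_distrib, Y_eq_sum, sum_powerset_insert hj, smul_add, smul_sum,
    smul_sum]
  congr 1
  · refine sum_congr rfl fun β hβ => ?_
    have hjβ : j ∉ β := fun h' => hj (mem_powerset.1 hβ h')
    rw [insert_sdiff_of_notMem _ hjβ, prod_insert (fun h' => hj (mem_sdiff.1 h').1), smul_smul]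
    congr 1
    ring
  · refine sum_congr rfl fun β hβ => ?_
    have hβJ := mem_powerset.1 hβ
    have sdiff_eq : insert j J \ insert j β = J \ β := by
      rw [insert_sdiff_insert, sdiff_insert_of_notMem hj]
    have prod_f_eq := prod_f_eq_prod_g_mul_prod_h hc (s := J \ β) (y := v j) fun l hl =>
      hv.ne (ne_of_mem_of_not_mem (mem_sdiff.1 hl).1 hj)
    simp only [sdiff_eq, prod_insert (fun h' => hj (hβJ h'))]
    rw [← smul_sub, ← mul_sub, ← hT.prod_smul_izerginSum_insert hc hu hv huv hvu hβJ hj, smul_smul,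
      mul_smul_comm, smul_smul, prod_mul_distrib, prod_f_eq, ← prod_sdiff hβJ]
    congr 1
    ring

end BetheVectors

section Actions

variable {A : Type*} [Ring A] [Algebra ℂ A] {ι κ : Type*} [LinearOrder ι] [LinearOrder κ]
  {c : ℂ} {T : Fin 3 → Fin 3 → ℂ → A} {u : ι → ℂ} {v : κ → ℂ}

theorem IsRTT.dressed1_opProd (hT : IsRTT c T) (hu : Function.Injective u) {I : Finset ι} {z : ℂ}
    (hz : ∀ i ∈ I, z ≠ u i) :
    dressed c T u 1 z 1 (opProd (T 0 1) u) I =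
      (∏ i ∈ I, f c z (u i)) • (opProd (T 0 1) u I * T 1 1 z) := by
  induction I using Finset.induction_on generalizing z with
  | empty => simp [dressed_apply, lower_empty, opProd_empty]
  | insert a I ha ih =>
    obtain ⟨hza, hzI⟩ := (forall_mem_insert a I _).1 hz
    have haI (i : ι) (hi : i ∈ I) : u a ≠ u i := hu.ne fun e : a = i => ha (e ▸ hi)
    have hT01 := hT.commute_same (i := 0) (j := 1) (by decide) (by decide)
    have lower_opProd_insert (φ : ℂ → ℂ) :
        lower c (T 1 1) u I φ (fun I' => opProd (T 0 1) u (insert a I')) =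
          T 0 1 (u a) * lower c (T 1 1) u I φ (opProd (T 0 1) u) := by
      rw [mul_lower]
      exact lower_congr (fun _ _ => rfl) fun i _ =>
        (mul_opProd hT01 fun h' => ha (mem_of_mem_erase h')).symm
    have ih_z := congrArg (fun W => f c z (u a) • (T 0 1 (u a) * W)) (ih hzI)
    have ih_a := congrArg (fun W => g c z (u a) • (T 0 1 z * W)) (ih haI)
    simp only [dressed_apply] at ih_z ih_a ⊢
    rw [lower_insert ha, lower_opProd_insert, lower_f_mul_g hza hzI haI, prod_insert ha,
      ← mul_opProd hT01 ha, ← mul_assoc (T 1 1 z), hT.T11_mul_T01 hza, Pi.one_apply, mul_one]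
    simp only [sub_mul, mul_sub, mul_add, smul_add, smul_mul_assoc, mul_smul_comm, mul_assoc,
      (hT01 z (u a)).left_comm] at ih_z ih_a ⊢
    linear_combination (norm := module) ih_z - ih_a

/-- The unwanted terms of the actions of `T_{12}(z)` and `T_{22}(z)` on `Y`: one of the variables
`v̄_J` is replaced by `z` and moved to the argument of `T_{22}` on the right. -/
def unwanted (c : ℂ) (T : Fin 3 → Fin 3 → ℂ → A) (u : ι → ℂ) (v : κ → ℂ) (J : Finset κ) (z : ℂ)
    (I : Finset ι) : A :=
  ∑ ρ ∈ J, (g c (v ρ) z * (∏ i ∈ I, f c (v ρ) (u i)) * ∏ l ∈ J.erase ρ, g c (v l) (v ρ)) •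
    (Y c T u v I (J.erase ρ) * T 1 1 (v ρ))

theorem IsRTT.dressed2_unwanted (hT : IsRTT c T) (hc : c ≠ 0)
    (hu : Function.Injective u) (hv : Function.Injective v) (huv : ∀ i j, u i ≠ v j)
    (hvv : ∀ j k, j ≠ k → h c (v j) (v k) ≠ 0) (hvu : ∀ j i, h c (v j) (u i) ≠ 0)
    {j : κ} {J : Finset κ} (hj : j ∉ J) (z : ℂ) (I : Finset ι) :
    dressed c T u 2 (v j) (fProd c v J) (unwanted c T u v J z) I =
      ∑ ρ ∈ J, (g c (v ρ) z * (∏ i ∈ I, f c (v ρ) (u i)) *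
          (∏ l ∈ J.erase ρ, g c (v l) (v ρ)) * ∏ l ∈ J.erase ρ, h c (v l) (v j)) •
        (Y c T u v I (insert j (J.erase ρ)) * T 1 1 (v ρ)) := by
  have unwanted_eq : unwanted c T u v J z =
      ∑ ρ ∈ J, (g c (v ρ) z * ∏ l ∈ J.erase ρ, g c (v l) (v ρ)) • fun I' =>
        (∏ i ∈ I', f c (v ρ) (u i)) • (Y c T u v I' (J.erase ρ) * T 1 1 (v ρ)) := by
    funext I'
    simp only [unwanted, Finset.sum_apply, Pi.smul_apply, smul_smul, mul_right_comm]
  rw [unwanted_eq, map_sum, Finset.sum_apply]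
  refine sum_congr rfl fun ρ hρ => ?_
  have hjρ : j ∉ J.erase ρ := fun h' => hj (mem_of_mem_erase h')
  rw [map_smul, Pi.smul_apply, ← insert_erase hρ, fProd_insert (notMem_erase ρ J),
    insert_erase hρ, dressed_f_mul (hT.commute_same (by decide) (by decide)),
    ← hT.prod_h_smul_Y_insert hc hu hv huv hvv hvu hjρ, smul_mul_assoc, smul_smul, smul_smul]
  congr 1
  ring

theorem IsRTT.prod_h_smul_unwanted_insert (hT : IsRTT c T) (hc : c ≠ 0)
    (hu : Function.Injective u) (hv : Function.Injective v) (huv : ∀ i j, u i ≠ v j)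
    (hvv : ∀ j k, j ≠ k → h c (v j) (v k) ≠ 0) (hvu : ∀ j i, h c (v j) (u i) ≠ 0)
    {j : κ} {J : Finset κ} (hj : j ∉ J) {z : ℂ} (hz : ∀ l ∈ insert j J, z ≠ v l) {I : Finset ι}
    (hJ : dressed c T u 1 (v j) (fProd c v J) (fun I' => Y c T u v I' J) I =
      (fProd c v J (v j) * ∏ i ∈ I, f c (v j) (u i)) • (Y c T u v I J * T 1 1 (v j)) -
        dressed c T u 2 (v j) (fProd c v J) (unwanted c T u v J (v j)) I) :
    (∏ l ∈ J, h c (v l) (v j)) • unwanted c T u v (insert j J) z I =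
      (g c (v j) z * h c z (v j)) •
          dressed c T u 2 (v j) (fProd c v J) (unwanted c T u v J z) I +
        g c (v j) z • dressed c T u 1 (v j) (fProd c v J) (fun I' => Y c T u v I' J) I := by
  have hjz : v j ≠ z := (hz j (mem_insert_self j J)).symm
  rw [hJ, hT.dressed2_unwanted hc hu hv huv hvv hvu hj,
    hT.dressed2_unwanted hc hu hv huv hvv hvu hj, unwanted, sum_insert hj, erase_insert hj,
    smul_add, smul_sub, add_sub_left_comm, smul_sum, smul_sum, smul_sum, ← sum_sub_distrib]
  congr 1
  · rw [smul_smul, smul_smul, fProd, prod_f_eq_prod_g_mul_prod_h hc fun l hl =>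
      hv.ne (ne_of_mem_of_not_mem hl hj)]
    congr 1
    ring
  · refine sum_congr rfl fun ρ hρ => ?_
    have hjρ : j ≠ ρ := fun e => hj (e ▸ hρ)
    have exchange := g_mul_h_mul_g_sub hc hjz (hv.ne hjρ.symm)
      (hz ρ (mem_insert_of_mem hρ)).symm
    rw [erase_insert_of_ne hjρ, prod_insert fun h' => hj (mem_of_mem_erase h'),
      ← mul_prod_erase J _ hρ, smul_smul, smul_smul, smul_smul, ← sub_smul, g_swap c (v ρ) (v j)]
    rw [f_eq_g_mul_h hc (hv.ne hjρ.symm)] at exchange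
    congr 1
    linear_combination (-(∏ i ∈ I, f c (v ρ) (u i)) * (∏ l ∈ J.erase ρ, g c (v l) (v ρ)) *
      ∏ l ∈ J.erase ρ, h c (v l) (v j)) * exchange

theorem IsRTT.dressed1_Y (hT : IsRTT c T) (hc : c ≠ 0)
    (hu : Function.Injective u) (hv : Function.Injective v) (huv : ∀ i j, u i ≠ v j)
    (hvv : ∀ j k, j ≠ k → h c (v j) (v k) ≠ 0) (hvu : ∀ j i, h c (v j) (u i) ≠ 0)
    {J : Finset κ} {z : ℂ} (hzv : ∀ l ∈ J, z ≠ v l) {I : Finset ι} (hzu : ∀ i ∈ I, z ≠ u i) :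
    dressed c T u 1 z (fProd c v J) (fun I' => Y c T u v I' J) I =
      (fProd c v J z * ∏ i ∈ I, f c z (u i)) • (Y c T u v I J * T 1 1 z) -
        dressed c T u 2 z (fProd c v J) (unwanted c T u v J z) I := by
  induction J using Finset.induction_on generalizing z I with
  | empty =>
    have fProd_empty : fProd c v ∅ = 1 := rfl
    have unwanted_empty : unwanted c T u v ∅ z = 0 := rfl
    rw [fProd_empty, unwanted_empty, map_zero]
    simpa [Y_empty] using hT.dressed1_opProd hu hzu
  | insert j J hj ih =>
    obtain ⟨hzj, hzJ⟩ := (forall_mem_insert j J _).1 hzv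
    have hju (I' : Finset ι) : ∀ i ∈ I', v j ≠ u i := fun i _ => (huv i j).symm
    have prod_h_ne_zero : ∏ l ∈ J, h c (v l) (v j) ≠ 0 :=
      prod_ne_zero_iff.2 fun l hl => hvv _ _ (ne_of_mem_of_not_mem hl hj)
    have Y_insert : (∏ l ∈ J, h c (v l) (v j)) • (fun I' => Y c T u v I' (insert j J)) =
        dressed c T u 2 (v j) (fProd c v J) (fun I' => Y c T u v I' J) :=
      funext fun I' => hT.prod_h_smul_Y_insert hc hu hv huv hvv hvu hj I'
    have unwanted_insert : (∏ l ∈ J, h c (v l) (v j)) • unwanted c T u v (insert j J) z =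
        (g c (v j) z * h c z (v j)) • dressed c T u 2 (v j) (fProd c v J) (unwanted c T u v J z) +
          g c (v j) z • dressed c T u 1 (v j) (fProd c v J) (fun I' => Y c T u v I' J) :=
      funext fun I' => hT.prod_h_smul_unwanted_insert hc hu hv huv hvv hvu hj hzv
        (ih (fun l hl => hv.ne (ne_of_mem_of_not_mem hl hj).symm) (hju I'))
    refine smul_right_injective A prod_h_ne_zero ?_
    dsimp only
    rw [fProd_insert hj, ← Pi.smul_apply, ← map_smul, Y_insert, smul_sub,
      ← Pi.smul_apply (_ : ℂ) (dressed c T u 2 z _ _), ← map_smul, unwanted_insert,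
      hT.dressed1_dressed2_eq_sub hc hu hzj.symm (hju I) hzu fun I' hI' =>
        ih hzJ fun i hi => hzu i (hI' hi), smul_comm, ← smul_mul_assoc (∏ l ∈ J, _), ← Y_insert]
    rfl

theorem IsRTT.T01_mul_Y (hT : IsRTT c T) (hc : c ≠ 0)
    (hu : Function.Injective u) (hv : Function.Injective v) (huv : ∀ i j, u i ≠ v j)
    (hvv : ∀ j k, j ≠ k → h c (v j) (v k) ≠ 0) (hvu : ∀ j i, h c (v j) (u i) ≠ 0)
    (J : Finset κ) {a : ι} {I : Finset ι} (ha : a ∉ I) :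
    T 0 1 (u a) * Y c T u v I J =
      Y c T u v (insert a I) J - T 0 2 (u a) * unwanted c T u v J (u a) I := by
  have hau {I' : Finset ι} (hI' : I' ⊆ I) : ∀ i ∈ I', u a ≠ u i :=
    fun i hi => hu.ne (ne_of_mem_of_not_mem (hI' hi) ha).symm
  induction J using Finset.induction_on generalizing I with
  | empty =>
    have unwanted_empty : unwanted c T u v ∅ (u a) I = 0 := rfl
    rw [unwanted_empty, mul_zero, sub_zero, Y_empty, Y_empty,
      mul_opProd (hT.commute_same (by decide) (by decide)) ha]
  | insert j J hj ih =>
    have prod_h_ne_zero : ∏ l ∈ J, h c (v l) (v j) ≠ 0 :=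
      prod_ne_zero_iff.2 fun l hl => hvv _ _ (ne_of_mem_of_not_mem hl hj)
    have unwanted_insert := hT.prod_h_smul_unwanted_insert hc hu hv huv hvv hvu hj (z := u a)
      (fun l _ => huv a l) (hT.dressed1_Y (I := I) hc hu hv huv hvv hvu
        (fun l hl => hv.ne (ne_of_mem_of_not_mem hl hj).symm) fun i _ => (huv i j).symm)
    refine smul_right_injective A prod_h_ne_zero ?_
    dsimp only
    rw [smul_sub, ← mul_smul_comm, ← mul_smul_comm, unwanted_insert,
      hT.prod_h_smul_Y_insert hc hu hv huv hvv hvu hj,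
      hT.prod_h_smul_Y_insert hc hu hv huv hvv hvu hj]
    exact hT.T01_mul_dressed2 hc (huv a j).symm ha (fun i _ => (huv i j).symm) (hau subset_rfl)
      (fun I' hI' => ih (fun h' => ha (hI' h')) fun hI'' => hau (hI''.trans hI'))
      (hT.dressed1_Y hc hu hv huv hvv hvu (fun l _ => huv a l) (hau subset_rfl))

end Actions

end

end GL21

theorem proposition2 {A : Type*} [Ring A] [Algebra ℂ A] (c : ℂ) (hc : c ≠ 0)
    (T : Fin 3 → Fin 3 → ℂ → A) (hT : GL21.IsRTT c T)
    (a b : ℕ) (u : Fin (a + 1) → ℂ) (v : Fin b → ℂ)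
    (hu : Function.Injective u) (hv : Function.Injective v)
    (huv : ∀ i j, u i ≠ v j)
    (hvv : ∀ j k, j ≠ k → GL21.h c (v j) (v k) ≠ 0)
    (hvu : ∀ j i, GL21.h c (v j) (u i) ≠ 0) :
    GL21.Y c T u v Finset.univ Finset.univ =
      T 0 1 (u (Fin.last a)) *
          GL21.Y c T u v (Finset.univ.erase (Fin.last a)) Finset.univ +
        ∑ ρ : Fin b,
          (GL21.g c (v ρ) (u (Fin.last a)) *
            (∏ i ∈ Finset.univ.erase (Fin.last a), GL21.f c (v ρ) (u i)) *
            (∏ j ∈ Finset.univ.erase ρ, GL21.g c (v j) (v ρ))) •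
            (T 0 2 (u (Fin.last a)) *
              GL21.Y c T u v (Finset.univ.erase (Fin.last a)) (Finset.univ.erase ρ) *
              T 1 1 (v ρ)) := by
  have action := hT.T01_mul_Y hc hu hv huv hvv hvu Finset.univ
    (Finset.notMem_erase (Fin.last a) Finset.univ)
  rw [Finset.insert_erase (Finset.mem_univ _)] at action
  rw [action, GL21.unwanted, Finset.mul_sum]
  simp only [mul_smul_comm, mul_assoc, sub_add_cancel]
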